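/- Let $D\ge 2$ be an integer. Let $\mathcal P^D$ be the class of nonempty open, bounded, convex sets $\Omega\subset\mathbb R^D$ and, for $r>0$, let $\mathcal P^D(r)$ be the subclass of those whose inradius $R_\Omega$ (supremum of the radii of balls contained in $\Omega$) equals $r$. For $p\in(1,\infty)$ and $\Omega\in\mathcal P^D$ let $u_p\in W^{1,p}_0(\Omega)$ be the weak solution of $-\operatorname{div}(|\nabla u|^{p-2}\nabla u)=1$ in $\Omega$, $u=0$ on $\partial\Omega$; put $$T_p(\Omega)=\int_\Omega u_p\,dx,\qquad T(p;\Omega)=|\Omega|^{p-1}\,T_p(\Omega)^{1-p},\qquad Q_p(\Omega)=\left(\frac{T(p;\Omega)\,R_\Omega^p}{\left(\frac{2p-1}{p-1}\right)^{p-1}}\right)^{1/p},$$ $$\gamma_{D,p}=\frac{\inf_{\Omega\in\mathcal P^D}Q_p(\Omega)}{\sup_{\Omega\in\mathcal P^D}Q_p(\Omega)},\qquad \gamma_D=\inf_{p\in(1,\infty)}\gamma_{D,p}.$$ Then $\gamma_D\in[1/D,1)$, and for all real numbers $0<a<b$ the following hold. 1. If $\gamma_D b<a$, then there exist $p\in(1,\infty)$,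 $\Omega_a\in\mathcal P^D(a)$ and $\Omega_b\in\mathcal P^D(b)$ such that $T(p;\Omega_a)<T(p;\Omega_b)$. 2. If $\gamma_D b\ge a$, then $T(p;\Omega_b)\le T(p;\Omega_a)$ for all $\Omega_a\in\mathcal P^D(a)$, all $\Omega_b\in\mathcal P^D(b)$ and all $p\in(1,\infty)$. 3. If $\gamma_D b>a$, then $T(p;\Omega_b)<T(p;\Omega_a)$ for all $\Omega_a\in\mathcal P^D(a)$, all $\Omega_b\in\mathcal P^D(b)$ and all $p\in(1,\infty)$. -/

import Mathlib

open MeasureTheory Filter Topology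
open scoped ContDiff

noncomputable section

namespace PTorsion

/-- The Euclidean space `ℝ^D`. -/
abbrev E (D : ℕ) : Type := EuclideanSpace ℝ (Fin D)

/-- Nonempty open bounded convex subsets of `ℝ^D`. -/
def convexDomains (D : ℕ) : Set (Set (E D)) :=
  {Ω | IsOpen Ω ∧ Bornology.IsBounded Ω ∧ Convex ℝ Ω ∧ Ω.Nonempty}

/-- The inradius: the supremum of the radii of the balls contained in `Ω`. -/
def inradius {D : ℕ} (Ω : Set (E D)) : ℝ :=
  sSup {r : ℝ | 0 < r ∧ ∃ x, Metric.ball x r ⊆ Ω}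

/-- Nonempty open bounded convex subsets of `ℝ^D` with inradius `r`. -/
def convexDomainsOfInradius (D : ℕ) (r : ℝ) : Set (Set (E D)) :=
  {Ω | Ω ∈ convexDomains D ∧ inradius Ω = r}

/-- Test functions: the elements of `C_c^∞(Ω)`. -/
def IsTestFunction {D : ℕ} (Ω : Set (E D)) (φ : E D → ℝ) : Prop :=
  ContDiff ℝ ∞ φ ∧ HasCompactSupport φ ∧ tsupport φ ⊆ Ω

/-- `u ∈ W^{1,p}(Ω)` with weak gradient `G`. -/
structure IsSobolev {D : ℕ} (p : ℝ) (Ω : Set (E D)) (u : E D → ℝ) (G : E D → E D) : Prop where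
  memLp : MemLp u (ENNReal.ofReal p) (volume.restrict Ω)
  memLp_grad : MemLp G (ENNReal.ofReal p) (volume.restrict Ω)
  weak_grad : ∀ φ : E D → ℝ, IsTestFunction Ω φ →
    ∫ x in Ω, u x • gradient φ x = -∫ x in Ω, φ x • G x

/-- `u ∈ W_0^{1,p}(Ω)` with weak gradient `G`: membership in `W^{1,p}(Ω)` together with
approximability by test functions in the norm of `W^{1,p}(Ω)`. -/
def IsSobolevZero {D : ℕ} (p : ℝ) (Ω : Set (E D)) (u : E D → ℝ) (G : E D → E D) : Prop :=
  IsSobolev p Ω u G ∧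
    ∃ φ : ℕ → E D → ℝ, (∀ n, IsTestFunction Ω (φ n)) ∧
      Tendsto (fun n => eLpNorm (fun x => u x - φ n x) (ENNReal.ofReal p) (volume.restrict Ω))
        atTop (𝓝 0) ∧
      Tendsto (fun n => eLpNorm (fun x => G x - gradient (φ n) x) (ENNReal.ofReal p)
        (volume.restrict Ω)) atTop (𝓝 0)

/-- `u` is a weak solution in `W_0^{1,p}(Ω)` of `-div (|∇u|^{p-2} ∇u) = 1` in `Ω`, `u = 0` on
the boundary of `Ω`. -/
def IsTorsionFunction {D : ℕ} (p : ℝ) (Ω : Set (E D)) (u : E D → ℝ) : Prop :=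
  ∃ G : E D → E D, IsSobolevZero p Ω u G ∧
    ∀ φ : E D → ℝ, IsTestFunction Ω φ →
      ∫ x in Ω, inner ℝ (‖G x‖ ^ (p - 2) • G x) (gradient φ x) = ∫ x in Ω, φ x

open Classical in
/-- The `p`-torsion function of `Ω` (zero if there is no weak solution). -/
def torsionFunction {D : ℕ} (p : ℝ) (Ω : Set (E D)) : E D → ℝ :=
  if h : ∃ u, IsTorsionFunction p Ω u then h.choose else 0

/-- The `p`-torsional rigidity `T_p(Ω)`, the integral of the `p`-torsion function. -/
def torsionalRigidity {D : ℕ} (p : ℝ) (Ω : Set (E D)) : ℝ :=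
  ∫ x in Ω, torsionFunction p Ω x

/-- The normalized `p`-torsional rigidity `T(p;Ω) = |Ω|^{p-1} T_p(Ω)^{1-p}`. -/
def normRigidity {D : ℕ} (p : ℝ) (Ω : Set (E D)) : ℝ :=
  volume.real Ω ^ (p - 1) * torsionalRigidity p Ω ^ (1 - p)

/-- The scale-invariant quantity
`Q_p(Ω) = (T(p;Ω) R_Ω^p / ((2p-1)/(p-1))^{p-1})^{1/p}`. -/
def Q {D : ℕ} (p : ℝ) (Ω : Set (E D)) : ℝ :=
  (normRigidity p Ω * inradius Ω ^ p / ((2 * p - 1) / (p - 1)) ^ (p - 1)) ^ (1 / p)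

/-- The infimum of `Q_p` over all convex domains. -/
def alpha (D : ℕ) (p : ℝ) : ℝ := ⨅ Ω : convexDomains D, Q p (Ω : Set (E D))

/-- The supremum of `Q_p` over all convex domains. -/
def beta (D : ℕ) (p : ℝ) : ℝ := ⨆ Ω : convexDomains D, Q p (Ω : Set (E D))

/-- The constant `γ_{D,p}`. -/
def gammaDp (D : ℕ) (p : ℝ) : ℝ := alpha D p / beta D p

/-- The constant `γ_D`, the infimum of `γ_{D,p}` over `p ∈ (1,∞)`. -/
def gammaD (D : ℕ) : ℝ := ⨅ p : Set.Ioi (1 : ℝ), gammaDp D (p : ℝ)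

end PTorsion

end

/-!
Write `q` for the conjugate exponent of `p` and `τ` for the mean of the `p`-torsion function over
`Ω`, so that `Q_p(Ω)^q = R_Ω^q / ((q + 1) τ)`. This is invariant under dilations, and for domains
`A`, `B` of inradii `a`, `b` one has `T(p; A) < T(p; B)` if and only if `Q_p(A) b < Q_p(B) a`. The
trichotomy in `γ_D b` and `a` is therefore a statement about the extremal values of `Q_p`, once
`1 ≤ Q_p ≤ D` is known and `Q_2` is known not to be constant.

Both bounds come from the variational principle `T_p(Ω) / q = sup (∫ φ - (1/p) ∫ |∇φ|^p)` over test
functions `φ`, whose supremum is attained at the torsion function because a maximising sequence is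
Cauchy by uniform convexity. For `Q_p ≥ 1` (Makai's inequality), enclose the support of `φ` in a
polyhedron inside `Ω`, cut it into the cells of points nearest to a given face, and bound `φ` along
the segments orthogonal to that face: they have length at most `R_Ω` and end where `φ` vanishes.
For `Q_p ≤ D`, test with a multiple of `1 - s^q`, where `s` is the gauge of `Ω` about the centre of
a ball of radius `r` in `Ω`; `s` has Lipschitz constant `1 / r`. Finally `Q_2` is strictly smaller
at the ellipsoid with one semiaxis `1` and the others `2` than at the unit ball.
-/

namespace PTorsion

section Gradient

variable {V : Type*} [NormedAddCommGroup V] [InnerProductSpace ℝ V] [CompleteSpace V] {φ : V → ℝ}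

lemma norm_gradient (φ : V → ℝ) (x : V) : ‖gradient φ x‖ = ‖fderiv ℝ φ x‖ := by
  rw [← toDual_gradient, LinearIsometryEquiv.norm_map]

lemma continuous_gradient_of_contDiff (h : ContDiff ℝ 1 φ) : Continuous (gradient φ) :=
  (InnerProductSpace.toDual ℝ V).symm.continuous.comp (h.continuous_fderiv one_ne_zero)

lemma tsupport_gradient_subset (φ : V → ℝ) : tsupport (gradient φ) ⊆ tsupport φ :=
  (tsupport_comp_subset (map_zero (InnerProductSpace.toDual ℝ V).symm) (fderiv ℝ φ)).trans
    (tsupport_fderiv_subset ℝ)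

lemma gradient_comp_smul (φ : V → ℝ) (c : ℝ) (x : V) :
    gradient (fun y => φ (c • y)) x = c • gradient φ (c • x) := by
  simp only [gradient]
  rw [← map_smul, fderiv_comp_smul]

lemma hasDerivAt_comp_add_smul (h : Differentiable ℝ φ) (x v : V) (t : ℝ) :
    HasDerivAt (fun t : ℝ => φ (x + t • v)) (inner ℝ (gradient φ (x + t • v)) v) t := by
  have h_line : HasDerivAt (fun t : ℝ => x + t • v) v t := by
    simpa using ((hasDerivAt_id t).smul_const v).const_add x
  rw [inner_gradient_left]
  exact (h (x + t • v)).hasFDerivAt.comp_hasDerivAt t h_line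

end Gradient

section NormRpow

variable {V : Type*} [SeminormedAddCommGroup V] {p : ℝ}

lemma continuous_norm_rpow {X : Type*} [TopologicalSpace X] {f : X → V} (hf : Continuous f)
    (hp : 0 ≤ p) : Continuous fun x => ‖f x‖ ^ p :=
  hf.norm.rpow_const fun _ => Or.inr hp

lemma norm_sub_rpow_le (hp : 1 ≤ p) (a b : V) :
    ‖a - b‖ ^ p ≤ 2 ^ (p - 1) * (‖a‖ ^ p + ‖b‖ ^ p) :=
  (Real.rpow_le_rpow (norm_nonneg _) (norm_sub_le a b) (zero_le_one.trans hp)).trans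
    (mod_cast NNReal.rpow_add_le_mul_rpow_add_rpow ‖a‖₊ ‖b‖₊ hp)

lemma norm_smul_rpow [NormedSpace ℝ V] {t : ℝ} (ht : 0 ≤ t) (p : ℝ) (v : V) :
    ‖t • v‖ ^ p = t ^ p * ‖v‖ ^ p := by
  rw [norm_smul, Real.norm_of_nonneg ht, Real.mul_rpow ht (norm_nonneg v)]

end NormRpow

section MidpointGap

variable {V : Type*} [NormedAddCommGroup V] [NormedSpace ℝ V] {p : ℝ}

/-- The convexity defect of `‖·‖ ^ p` at the midpoint of `a` and `b`. Its lower bounds play the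
role of Clarkson's inequalities, uniformly in the exponent `p > 1`. -/
noncomputable def midpointGap (p : ℝ) (a b : V) : ℝ :=
  (‖a‖ ^ p + ‖b‖ ^ p) / 2 - ‖(1 / 2 : ℝ) • (a + b)‖ ^ p

lemma norm_half_smul_add (a b : V) : ‖(1 / 2 : ℝ) • (a + b)‖ = ‖a + b‖ / 2 := by
  rw [norm_smul, Real.norm_of_nonneg (by norm_num)]
  ring

lemma midpointGap_pos [StrictConvexSpace ℝ V] (hp : 1 < p) {a b : V} (hab : a ≠ b) :
    0 < midpointGap p a b := by
  have hp₀ : 0 < p := zero_lt_one.trans hp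
  rw [midpointGap, sub_pos, norm_half_smul_add]
  by_cases hnorm : ‖a‖ = ‖b‖
  · have h_ray : ¬ SameRay ℝ a b := fun h => hab ((sameRay_iff_of_norm_eq hnorm).1 h)
    calc (‖a + b‖ / 2) ^ p < ‖a‖ ^ p := by
          have := norm_add_lt_of_not_sameRay h_ray
          exact Real.rpow_lt_rpow (by positivity) (by linarith) hp₀
      _ = (‖a‖ ^ p + ‖b‖ ^ p) / 2 := by rw [← hnorm]; ring
  · have h_convex := (strictConvexOn_rpow hp).2 (norm_nonneg a) (norm_nonneg b) hnorm
      (half_pos one_pos) (half_pos one_pos) (add_halves 1)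
    simp only [smul_eq_mul] at h_convex
    calc (‖a + b‖ / 2) ^ p ≤ (1 / 2 * ‖a‖ + 1 / 2 * ‖b‖) ^ p :=
          Real.rpow_le_rpow (by positivity) (by linarith [norm_add_le a b]) hp₀.le
      _ < (‖a‖ ^ p + ‖b‖ ^ p) / 2 := by linarith

lemma midpointGap_self (p : ℝ) (a : V) : midpointGap p a a = 0 := by
  rw [midpointGap, ← two_smul ℝ a, smul_smul, one_div_mul_cancel two_ne_zero, one_smul]
  ring

lemma midpointGap_nonneg [StrictConvexSpace ℝ V] (hp : 1 < p) (a b : V) :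
    0 ≤ midpointGap p a b := by
  rcases eq_or_ne a b with rfl | hab
  · exact (midpointGap_self p a).ge
  · exact (midpointGap_pos hp hab).le

lemma continuous_midpointGap (hp : 0 ≤ p) :
    Continuous fun z : V × V => midpointGap p z.1 z.2 :=
  (((continuous_norm_rpow continuous_fst hp).add
    (continuous_norm_rpow continuous_snd hp)).div_const 2).sub
    (continuous_norm_rpow (by fun_prop) hp)

lemma midpointGap_smul {t : ℝ} (ht : 0 ≤ t) (p : ℝ) (a b : V) :
    midpointGap p (t • a) (t • b) = t ^ p * midpointGap p a b := by
  simp only [midpointGap, ← smul_add, smul_comm (1 / 2 : ℝ) t, norm_smul_rpow ht]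
  ring

lemma exists_pos_le_midpointGap [ProperSpace V] [StrictConvexSpace ℝ V] (hp : 1 < p) {ε : ℝ}
    (hε : 0 < ε) :
    ∃ δ > 0, ∀ a b : V, ‖a‖ ^ p + ‖b‖ ^ p = 1 → ε ≤ ‖a - b‖ ^ p → δ ≤ midpointGap p a b := by
  have hp₀ : 0 < p := zero_lt_one.trans hp
  let S : Set (V × V) := {z | ‖z.1‖ ^ p + ‖z.2‖ ^ p = 1 ∧ ε ≤ ‖z.1 - z.2‖ ^ p}
  have h_closed : IsClosed S :=
    (isClosed_eq ((continuous_norm_rpow continuous_fst hp₀.le).add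
      (continuous_norm_rpow continuous_snd hp₀.le)) continuous_const).inter
      (isClosed_le continuous_const
        (continuous_norm_rpow (continuous_fst.sub continuous_snd) hp₀.le))
  have h_bdd : Bornology.IsBounded S := by
    refine Metric.isBounded_closedBall (x := (0 : V × V)) (r := 1) |>.subset fun z hz => ?_
    have h_le {s t : ℝ} (hs : 0 ≤ s) (ht : 0 ≤ t) (hst : s ^ p + t ^ p = 1) : s ≤ 1 :=
      (Real.rpow_le_rpow_iff hs zero_le_one hp₀).1 (by
        linarith [Real.rpow_nonneg ht p, Real.one_rpow p])
    simpa [Prod.norm_def] using And.intro (h_le (norm_nonneg _) (norm_nonneg _) hz.1)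
      (h_le (norm_nonneg _) (norm_nonneg _) ((add_comm _ _).trans hz.1))
  rcases S.eq_empty_or_nonempty with h_empty | h_ne
  · exact ⟨1, one_pos, fun a b hab hε' => absurd ⟨hab, hε'⟩
      (Set.eq_empty_iff_forall_notMem.1 h_empty (a, b))⟩
  · obtain ⟨z, hz, h_min⟩ := (Metric.isCompact_of_isClosed_isBounded h_closed h_bdd).exists_isMinOn
      h_ne (continuous_midpointGap hp₀.le).continuousOn
    have hz_ne : z.1 ≠ z.2 := fun h => by
      have := hz.2
      rw [h, sub_self, norm_zero, Real.zero_rpow hp₀.ne'] at this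
      linarith
    exact ⟨_, midpointGap_pos hp hz_ne, fun a b hab hε' =>
      isMinOn_iff.1 h_min (a, b) ⟨hab, hε'⟩⟩

lemma exists_norm_sub_rpow_le_midpointGap [ProperSpace V] [StrictConvexSpace ℝ V] (hp : 1 < p)
    {ε : ℝ} (hε : 0 < ε) :
    ∃ K : ℝ, 0 ≤ K ∧ ∀ a b : V,
      ‖a - b‖ ^ p ≤ ε * (‖a‖ ^ p + ‖b‖ ^ p) + K * midpointGap p a b := by
  have hp₀ : 0 < p := zero_lt_one.trans hp
  obtain ⟨δ, hδ, h_gap⟩ := exists_pos_le_midpointGap (V := V) hp hε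
  have h_unit (a b : V) (hab : ‖a‖ ^ p + ‖b‖ ^ p = 1) :
      ‖a - b‖ ^ p ≤ ε + 2 ^ (p - 1) / δ * midpointGap p a b := by
    by_cases hε' : ε ≤ ‖a - b‖ ^ p
    · calc ‖a - b‖ ^ p ≤ 2 ^ (p - 1) / δ * δ := by
            simpa [hab, hδ.ne'] using norm_sub_rpow_le hp.le a b
        _ ≤ 2 ^ (p - 1) / δ * midpointGap p a b := by gcongr; exact h_gap a b hab hε'
        _ ≤ _ := le_add_of_nonneg_left hε.le
    · have := midpointGap_nonneg hp a b
      exact (not_le.1 hε').le.trans (le_add_of_nonneg_right (by positivity))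
  refine ⟨2 ^ (p - 1) / δ, by positivity, fun a b => ?_⟩
  set s := ‖a‖ ^ p + ‖b‖ ^ p with hs
  rcases (show 0 ≤ s by positivity).eq_or_lt with hs₀ | hs₀
  · have := midpointGap_nonneg hp a b
    calc ‖a - b‖ ^ p ≤ 0 := by simpa [← hs, ← hs₀] using norm_sub_rpow_le hp.le a b
      _ ≤ ε * s + 2 ^ (p - 1) / δ * midpointGap p a b := by positivity
  · have ht : (s ^ (-p⁻¹)) ^ p = s⁻¹ := by
      rw [← Real.rpow_mul hs₀.le, neg_mul, inv_mul_cancel₀ hp₀.ne', Real.rpow_neg_one]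
    have ht₀ : 0 ≤ s ^ (-p⁻¹) := by positivity
    have h_scaled := h_unit (s ^ (-p⁻¹) • a) (s ^ (-p⁻¹) • b) (by
      rw [norm_smul_rpow ht₀, norm_smul_rpow ht₀, ht, ← mul_add, inv_mul_cancel₀ hs₀.ne'])
    rw [← smul_sub, norm_smul_rpow ht₀, midpointGap_smul ht₀, ht, inv_mul_le_iff₀ hs₀] at h_scaled
    exact h_scaled.trans_eq (by field_simp)

end MidpointGap

section LineAverages

variable {V : Type*} [NormedAddCommGroup V] [NormedSpace ℝ V] [SecondCountableTopology V]
  [MeasurableSpace V] [BorelSpace V] {μ : Measure V} [SFinite μ] [μ.IsAddRightInvariant]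
  {F : V → ℝ} {v : V}

lemma integral_eq_setIntegral_line_integral (hF : Integrable F μ) {S : Set V}
    (hS : MeasurableSet S) (hS_line : ∀ y, volume.real {t : ℝ | y - t • v ∈ S} = 1) :
    ∫ y, F y ∂μ = ∫ x in S, (∫ t : ℝ, F (x + t • v)) ∂μ := by
  let A : Set (ℝ × V) := {z | z.2 - z.1 • v ∈ S}
  let G : ℝ × V → ℝ := A.indicator fun z => F z.2
  have hA : MeasurableSet A := hS.preimage (by fun_prop)
  have hA_line (y : V) : MeasurableSet {t : ℝ | y - t • v ∈ S} := hS.preimage (by fun_prop)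
  have hG_line (y : V) :
      (fun t => G (t, y)) = {t : ℝ | y - t • v ∈ S}.indicator fun _ => F y := rfl
  have hG : Integrable G (volume.prod μ) := by
    refine (integrable_prod_iff' (hF.1.comp_snd.indicator hA)).2 ⟨ae_of_all _ fun y => ?_, ?_⟩
    · rw [show (fun t => _) = _ from hG_line y, integrable_indicator_iff (hA_line y)]
      exact integrableOn_const (fun h => by simpa [Measure.real, h] using hS_line y)
    · refine hF.norm.congr (ae_of_all _ fun y => ?_)
      have h_norm (t : ℝ) : ‖G (t, y)‖ = {t : ℝ | y - t • v ∈ S}.indicator (fun _ => ‖F y‖) t :=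
        norm_indicator_eq_indicator_norm _ _
      change _ = ∫ t, ‖G (t, y)‖
      simp only [h_norm]
      rw [integral_indicator (hA_line y), setIntegral_const, hS_line, one_smul]
  have h_shear : MeasurePreserving (fun z : ℝ × V => (z.1, z.2 + z.1 • v))
      (volume.prod μ) (volume.prod μ) :=
    (MeasurePreserving.id volume).skew_product (g := fun t x => x + t • v) (by fun_prop)
      (ae_of_all _ fun t => map_add_right_eq_self μ (t • v))
  calc ∫ y, F y ∂μ = ∫ y, (∫ t, G (t, y)) ∂μ := by
        congr with y
        rw [hG_line, integral_indicator (hA_line y), setIntegral_const, hS_line, one_smul]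
    _ = ∫ z, G z ∂volume.prod μ := (integral_prod_symm G hG).symm
    _ = ∫ z : ℝ × V, G (z.1, z.2 + z.1 • v) ∂volume.prod μ := by
        conv_lhs => rw [← h_shear.map_eq]
        exact integral_map h_shear.aemeasurable (h_shear.map_eq.symm ▸ hG.1)
    _ = ∫ x, (∫ t : ℝ, G (t, x + t • v)) ∂μ :=
        integral_prod_symm _ (h_shear.integrable_comp_of_integrable hG)
    _ = ∫ x in S, (∫ t : ℝ, F (x + t • v)) ∂μ := by
        rw [← integral_indicator hS]
        congr with x
        by_cases hx : x ∈ S <;> simp [G, A, Set.indicator, hx]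

lemma integral_nonpos_of_line_integral_nonpos (hF : Integrable F μ) (hv : v ≠ 0)
    (h : ∀ x, ∫ t : ℝ, F (x + t • v) ≤ 0) : ∫ x, F x ∂μ ≤ 0 := by
  obtain ⟨ℓ, hℓ⟩ := SeparatingDual.exists_eq_one (R := ℝ) hv
  have h_slab (y : V) : {t : ℝ | y - t • v ∈ ℓ ⁻¹' Set.Ico 0 1} = Set.Ioc (ℓ y - 1) (ℓ y) := by
    ext t
    simp only [Set.mem_ofPred_eq, Set.mem_preimage, map_sub, map_smul, hℓ, Set.mem_Ico,
      Set.mem_Ioc, smul_eq_mul, mul_one]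
    constructor <;> rintro ⟨h_left, h_right⟩ <;> constructor <;> linarith
  rw [integral_eq_setIntegral_line_integral (S := ℓ ⁻¹' Set.Ico 0 1) (v := v) hF
    (ℓ.measurable measurableSet_Ico) fun y => by rw [h_slab]; simp]
  exact integral_nonpos h

end LineAverages

section OneDimensional

variable {p q a b : ℝ} {f g : ℝ → ℝ}

lemma intervalIntegral_abs_sub_rpow (hab : a ≤ b) (hq : 0 ≤ q) :
    ∫ t in a..b, |t - a| ^ q = (b - a) ^ (q + 1) / (q + 1) := by
  calc ∫ t in a..b, |t - a| ^ q = ∫ t in a..b, (t - a) ^ q := by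
        refine intervalIntegral.integral_congr fun t ht => ?_
        rw [Set.uIcc_of_le hab] at ht
        simp only [abs_of_nonneg (sub_nonneg.2 ht.1)]
    _ = (b - a) ^ (q + 1) / (q + 1) := by
        rw [intervalIntegral.integral_comp_sub_right (fun t => t ^ q) a,
          integral_rpow (Or.inl (by linarith)), sub_self, Real.zero_rpow (by linarith), sub_zero]

/- The bound is attained by `f t = ((b - a) ^ q - (t - a) ^ q) / q`; it comes from integrating
`f` by parts against `t - a` and applying Young's inequality. -/
lemma intervalIntegral_sub_abs_deriv_rpow_le (hpq : p.HolderConjugate q) (hab : a ≤ b)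
    (hf : ∀ t, HasDerivAt f (g t) t) (hg : Continuous g) (hb : f b = 0) :
    ∫ t in a..b, (f t - 1 / p * |g t| ^ p) ≤ (b - a) ^ (q + 1) / (q * (q + 1)) := by
  have hfc : Continuous f := continuous_iff_continuousAt.2 fun t => (hf t).continuousAt
  have hgp : Continuous fun t => |g t| ^ p := continuous_norm_rpow hg hpq.nonneg
  have h_weight : Continuous fun t : ℝ => |t - a| ^ q :=
    continuous_norm_rpow (continuous_sub_right a) hpq.symm.nonneg
  have h_parts : ∫ t in a..b, f t = ∫ t in a..b, -((t - a) * g t) := by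
    have := intervalIntegral.integral_mul_deriv_eq_deriv_mul (a := a) (b := b)
      (u := fun t => t - a) (u' := fun _ => 1) (v := f) (v' := g)
      (fun t _ => (hasDerivAt_id t).sub_const a) (fun t _ => hf t)
      (by simp) (hg.intervalIntegrable _ _)
    simp only [hb, sub_self, zero_mul, mul_zero, one_mul, zero_sub] at this
    rw [intervalIntegral.integral_neg, this, neg_neg]
  have h_young (t : ℝ) : -((t - a) * g t) - 1 / p * |g t| ^ p ≤ |t - a| ^ q / q := by
    have := Real.young_inequality_of_nonneg (abs_nonneg (g t)) (abs_nonneg (t - a)) hpq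
    have := neg_abs_le ((t - a) * g t)
    rw [abs_mul, mul_comm |t - a|] at this
    linarith [one_div_mul_eq_div p (|g t| ^ p)]
  calc ∫ t in a..b, (f t - 1 / p * |g t| ^ p)
      = ∫ t in a..b, (-((t - a) * g t) - 1 / p * |g t| ^ p) := by
        rw [intervalIntegral.integral_sub (hfc.intervalIntegrable _ _)
          ((hgp.const_mul _).intervalIntegrable _ _), h_parts, ← intervalIntegral.integral_sub]
        · exact Continuous.intervalIntegrable (by fun_prop) _ _
        · exact (hgp.const_mul _).intervalIntegrable _ _
    _ ≤ ∫ t in a..b, |t - a| ^ q / q :=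
        intervalIntegral.integral_mono_on hab
          (Continuous.intervalIntegrable (by fun_prop) _ _)
          ((h_weight.div_const q).intervalIntegrable _ _) fun t _ => h_young t
    _ = (b - a) ^ (q + 1) / (q * (q + 1)) := by
        rw [intervalIntegral.integral_div, intervalIntegral_abs_sub_rpow hab hpq.symm.nonneg,
          div_div, mul_comm]

lemma intervalIntegral_abs_rpow_le (hp : 1 ≤ p) (hab : a ≤ b) (hg : Continuous g) :
    (∫ t in a..b, |g t|) ^ p ≤ (b - a) ^ (p - 1) * ∫ t in a..b, |g t| ^ p := by
  have hp₀ : 0 ≤ p := zero_le_one.trans hp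
  rcases hab.eq_or_lt with rfl | hab'
  · simp [(zero_lt_one.trans_le hp).ne']
  have h_len : 0 < b - a := sub_pos.2 hab'
  have h_jensen := (convexOn_rpow hp).map_set_average_le (μ := volume) (t := Set.Ioc a b)
    (f := fun t => |g t|) (Real.continuous_rpow_const hp₀).continuousOn isClosed_Ici
    (by simpa using hab') (by simp) (ae_of_all _ fun t => abs_nonneg (g t))
    (hg.abs.integrableOn_Ioc) ((continuous_norm_rpow hg hp₀).integrableOn_Ioc)
  simp only [setAverage_eq, Real.volume_real_Ioc_of_le hab, smul_eq_mul,
    ← intervalIntegral.integral_of_le hab] at h_jensen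
  have h_nonneg : 0 ≤ ∫ t in a..b, |g t| :=
    intervalIntegral.integral_nonneg hab fun t _ => abs_nonneg _
  rw [Real.mul_rpow (by positivity) h_nonneg, Real.inv_rpow h_len.le,
    inv_mul_le_iff₀ (by positivity)] at h_jensen
  rwa [Real.rpow_sub_one h_len.ne', div_mul_eq_mul_div, mul_div_assoc, div_eq_inv_mul]

lemma intervalIntegral_abs_rpow_le_deriv (hp : 1 ≤ p) (hab : a ≤ b)
    (hf : ∀ t, HasDerivAt f (g t) t) (hg : Continuous g) (ha : f a = 0) :
    ∫ t in a..b, |f t| ^ p ≤ (b - a) ^ p * ∫ t in a..b, |g t| ^ p := by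
  have hp₀ : 0 ≤ p := zero_le_one.trans hp
  have hfc : Continuous f := continuous_iff_continuousAt.2 fun t => (hf t).continuousAt
  have h_abs : ∀ t ∈ Set.Icc a b, |f t| ≤ ∫ s in a..b, |g s| := fun t ht => by
    calc |f t| = |∫ s in a..t, g s| := by
          rw [intervalIntegral.integral_eq_sub_of_hasDerivAt (fun s _ => hf s)
            (hg.intervalIntegrable _ _), ha, sub_zero]
      _ ≤ ∫ s in a..t, |g s| := intervalIntegral.abs_integral_le_integral_abs ht.1
      _ ≤ ∫ s in a..b, |g s| := intervalIntegral.integral_mono_interval le_rfl ht.1 ht.2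
          (ae_of_all _ fun s => abs_nonneg _) (hg.abs.intervalIntegrable _ _)
  calc ∫ t in a..b, |f t| ^ p
      ≤ ∫ _ in a..b, (b - a) ^ (p - 1) * ∫ s in a..b, |g s| ^ p :=
        intervalIntegral.integral_mono_on hab
          ((continuous_norm_rpow hfc hp₀).intervalIntegrable a b) intervalIntegrable_const
          fun t ht => (Real.rpow_le_rpow (abs_nonneg _) (h_abs t ht) hp₀).trans
            (intervalIntegral_abs_rpow_le hp hab hg)
    _ = (b - a) ^ p * ∫ t in a..b, |g t| ^ p := by
        rw [intervalIntegral.integral_const, smul_eq_mul, ← mul_assoc, mul_comm (b - a),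
          ← Real.rpow_add_one' (sub_nonneg.2 hab) (by linarith), sub_add_cancel]

end OneDimensional

section DirectionalDerivative

variable {V : Type*} [NormedAddCommGroup V] [InnerProductSpace ℝ V] [CompleteSpace V]
  {p q a b R : ℝ} {φ : V → ℝ} {x v : V}

lemma continuous_inner_gradient_line (hφ : ContDiff ℝ 1 φ) :
    Continuous fun t : ℝ => inner ℝ (gradient φ (x + t • v)) v :=
  ((continuous_gradient_of_contDiff hφ).comp (by fun_prop)).inner continuous_const

lemma abs_inner_gradient_rpow_le (hp : 0 ≤ p) (hv : ‖v‖ ≤ 1) (y : V) :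
    |inner ℝ (gradient φ y) v| ^ p ≤ ‖gradient φ y‖ ^ p := by
  gcongr
  exact (abs_real_inner_le_norm _ _).trans (mul_le_of_le_one_right (norm_nonneg _) hv)

lemma intervalIntegral_line_energy_le (hpq : p.HolderConjugate q) (hφ : ContDiff ℝ 1 φ)
    (hv : ‖v‖ ≤ 1) (hab : a ≤ b) (hR : b - a ≤ R) (hb : φ (x + b • v) = 0) :
    ∫ t in a..b, (φ (x + t • v) - 1 / p * ‖gradient φ (x + t • v)‖ ^ p) ≤
      ∫ _ in a..b, R ^ q / (q * (q + 1)) := by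
  have hq := hpq.symm.pos
  have h_line : Continuous fun t : ℝ => x + t • v := by fun_prop
  have h_deriv := continuous_inner_gradient_line (x := x) (v := v) hφ
  have h_length : 0 ≤ b - a := sub_nonneg.2 hab
  calc ∫ t in a..b, (φ (x + t • v) - 1 / p * ‖gradient φ (x + t • v)‖ ^ p)
      ≤ ∫ t in a..b, (φ (x + t • v) - 1 / p * |inner ℝ (gradient φ (x + t • v)) v| ^ p) := by
        refine intervalIntegral.integral_mono_on hab
          (((hφ.continuous.comp h_line).sub ((continuous_norm_rpow
            ((continuous_gradient_of_contDiff hφ).comp h_line) hpq.nonneg).const_mul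
            _)).intervalIntegrable _ _)
          (((hφ.continuous.comp h_line).sub ((continuous_norm_rpow h_deriv
            hpq.nonneg).const_mul _)).intervalIntegrable _ _) fun t _ => ?_
        have := hpq.pos
        gcongr ?_ - 1 / p * ?_
        exact abs_inner_gradient_rpow_le hpq.nonneg hv _
    _ ≤ (b - a) ^ (q + 1) / (q * (q + 1)) :=
        intervalIntegral_sub_abs_deriv_rpow_le hpq hab
          (hasDerivAt_comp_add_smul (hφ.differentiable one_ne_zero) x v) h_deriv hb
    _ ≤ (b - a) * (R ^ q / (q * (q + 1))) := by
        rw [Real.rpow_add_one' h_length (by positivity), mul_comm ((b - a) ^ q), mul_div_assoc]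
        gcongr
    _ = ∫ _ in a..b, R ^ q / (q * (q + 1)) := by
        rw [intervalIntegral.integral_const, smul_eq_mul]

lemma intervalIntegral_line_poincare (hp : 1 ≤ p) (hφ : ContDiff ℝ 1 φ) (hv : ‖v‖ ≤ 1)
    (hab : a ≤ b) (ha : φ (x + a • v) = 0) :
    ∫ t in a..b, ‖φ (x + t • v)‖ ^ p ≤
      (b - a) ^ p * ∫ t in a..b, ‖gradient φ (x + t • v)‖ ^ p := by
  have hp₀ : 0 ≤ p := zero_le_one.trans hp
  have h_deriv := continuous_inner_gradient_line (x := x) (v := v) hφ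
  refine (intervalIntegral_abs_rpow_le_deriv hp hab (hasDerivAt_comp_add_smul
    (hφ.differentiable one_ne_zero) x v) h_deriv ha).trans ?_
  refine mul_le_mul_of_nonneg_left ?_ (Real.rpow_nonneg (sub_nonneg.2 hab) p)
  exact intervalIntegral.integral_mono_on hab
    ((continuous_norm_rpow h_deriv hp₀).intervalIntegrable _ _)
    ((continuous_norm_rpow ((continuous_gradient_of_contDiff hφ).comp (by fun_prop))
      hp₀).intervalIntegrable _ _)
    fun t _ => abs_inner_gradient_rpow_le hp₀ hv _

end DirectionalDerivative

section TestFunctions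

variable {D : ℕ} {Ω : Set (E D)} {p : ℝ} {φ ψ : E D → ℝ}

namespace IsTestFunction

lemma continuous (h : IsTestFunction Ω φ) : Continuous φ := h.1.continuous

lemma contDiff_one (h : IsTestFunction Ω φ) : ContDiff ℝ 1 φ := h.1.of_le (by simp)

lemma differentiable (h : IsTestFunction Ω φ) : Differentiable ℝ φ :=
  h.1.differentiable (by simp)

lemma continuous_gradient (h : IsTestFunction Ω φ) : Continuous (gradient φ) :=
  continuous_gradient_of_contDiff h.contDiff_one

lemma hasCompactSupport_gradient (h : IsTestFunction Ω φ) : HasCompactSupport (gradient φ) :=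
  h.2.1.of_isClosed_subset (isClosed_tsupport _) (tsupport_gradient_subset φ)

lemma eq_zero (h : IsTestFunction Ω φ) {x : E D} (hx : x ∉ Ω) : φ x = 0 :=
  image_eq_zero_of_notMem_tsupport fun hx' => hx (h.2.2 hx')

lemma gradient_eq_zero (h : IsTestFunction Ω φ) {x : E D} (hx : x ∉ Ω) : gradient φ x = 0 :=
  image_eq_zero_of_notMem_tsupport fun hx' => hx (h.2.2 (tsupport_gradient_subset φ hx'))

lemma zero (Ω : Set (E D)) : IsTestFunction Ω 0 :=
  ⟨contDiff_const, HasCompactSupport.zero, by simp [tsupport]⟩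

lemma add (h : IsTestFunction Ω φ) (h' : IsTestFunction Ω ψ) :
    IsTestFunction Ω (fun x => φ x + ψ x) :=
  ⟨h.1.add h'.1, h.2.1.add h'.2.1,
    (tsupport_add φ ψ).trans (Set.union_subset h.2.2 h'.2.2)⟩

lemma const_mul (h : IsTestFunction Ω φ) (c : ℝ) : IsTestFunction Ω (fun x => c * φ x) :=
  ⟨contDiff_const.mul h.1, h.2.1.mul_left,
    (tsupport_mul_subset_right (f := fun _ => c) (g := φ)).trans h.2.2⟩

lemma sub (h : IsTestFunction Ω φ) (h' : IsTestFunction Ω ψ) :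
    IsTestFunction Ω (fun x => φ x - ψ x) := by
  simpa [sub_eq_add_neg] using h.add (h'.const_mul (-1))

lemma gradient_add (h : IsTestFunction Ω φ) (h' : IsTestFunction Ω ψ) (x : E D) :
    gradient (fun x => φ x + ψ x) x = gradient φ x + gradient ψ x := by
  simp only [gradient]
  rw [fderiv_fun_add (h.differentiable x) (h'.differentiable x), map_add]

lemma gradient_const_mul (h : IsTestFunction Ω φ) (c : ℝ) (x : E D) :
    gradient (fun x => c * φ x) x = c • gradient φ x := by
  simp only [gradient]
  rw [fderiv_const_mul (h.differentiable x), map_smul]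

lemma gradient_sub (h : IsTestFunction Ω φ) (h' : IsTestFunction Ω ψ) (x : E D) :
    gradient (fun x => φ x - ψ x) x = gradient φ x - gradient ψ x := by
  simp only [gradient]
  rw [fderiv_fun_sub (h.differentiable x) (h'.differentiable x), map_sub]

section Integrability

variable (h : IsTestFunction Ω φ) (μ : Measure (E D)) [IsFiniteMeasureOnCompacts μ]
include h

lemma memLp (r : ENNReal) : MemLp φ r μ :=
  h.continuous.memLp_of_hasCompactSupport h.2.1

lemma memLp_gradient (r : ENNReal) : MemLp (gradient φ) r μ :=
  h.continuous_gradient.memLp_of_hasCompactSupport h.hasCompactSupport_gradient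

lemma integrable : Integrable φ μ :=
  h.continuous.integrable_of_hasCompactSupport h.2.1

lemma integrable_norm_rpow (hp : 0 < p) : Integrable (fun x => ‖φ x‖ ^ p) μ :=
  (continuous_norm_rpow h.continuous hp.le).integrable_of_hasCompactSupport
    (h.2.1.comp_left (g := fun v => ‖v‖ ^ p) (by simp [Real.zero_rpow hp.ne']))

lemma integrable_norm_gradient_rpow (hp : 0 < p) :
    Integrable (fun x => ‖gradient φ x‖ ^ p) μ :=
  (continuous_norm_rpow h.continuous_gradient hp.le).integrable_of_hasCompactSupport
    (h.hasCompactSupport_gradient.comp_left (g := fun v => ‖v‖ ^ p)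
      (by simp [Real.zero_rpow hp.ne']))

end Integrability

lemma setIntegral_eq (h : IsTestFunction Ω φ) : ∫ x in Ω, φ x = ∫ x, φ x :=
  setIntegral_eq_integral_of_forall_compl_eq_zero fun _ hx => h.eq_zero hx

lemma setIntegral_norm_rpow_eq (h : IsTestFunction Ω φ) (hp : p ≠ 0) :
    ∫ x in Ω, ‖φ x‖ ^ p = ∫ x, ‖φ x‖ ^ p :=
  setIntegral_eq_integral_of_forall_compl_eq_zero fun _ hx => by
    simp [h.eq_zero hx, Real.zero_rpow hp]

lemma setIntegral_norm_gradient_rpow_eq (h : IsTestFunction Ω φ) (hp : p ≠ 0) :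
    ∫ x in Ω, ‖gradient φ x‖ ^ p = ∫ x, ‖gradient φ x‖ ^ p :=
  setIntegral_eq_integral_of_forall_compl_eq_zero fun _ hx => by
    simp [h.gradient_eq_zero hx, Real.zero_rpow hp]

lemma integrable_smul_gradient (h : IsTestFunction Ω φ) (h' : IsTestFunction Ω ψ) :
    Integrable fun x => φ x • gradient ψ x :=
  (h.continuous.smul h'.continuous_gradient).integrable_of_hasCompactSupport h.2.1.smul_right

lemma integral_smul_gradient (h : IsTestFunction Ω φ) (h' : IsTestFunction Ω ψ) :
    ∫ x, φ x • gradient ψ x = -∫ x, ψ x • gradient φ x := by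
  refine ext_inner_left ℝ fun v : E D => ?_
  have h_inner (f g : E D → ℝ) (x : E D) :
      inner ℝ v (f x • gradient g x) = f x * fderiv ℝ g x v := by
    rw [inner_smul_right, real_inner_comm, inner_gradient_left]
  have h_int {f g : E D → ℝ} (hf : IsTestFunction Ω f) (hg : IsTestFunction Ω g) :
      Integrable (fun x => f x * fderiv ℝ g x v) := by
    simpa only [h_inner] using (hf.integrable_smul_gradient hg).const_inner (𝕜 := ℝ) v
  rw [inner_neg_right, ← integral_inner (h.integrable_smul_gradient h'),
    ← integral_inner (h'.integrable_smul_gradient h)]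
  simp only [h_inner]
  rw [integral_mul_fderiv_eq_neg_fderiv_mul_of_integrable
    (by simpa only [mul_comm] using h_int h' h) (h_int h h')
    ((h.continuous.mul h'.continuous).integrable_of_hasCompactSupport h.2.1.mul_right)
    (fun x _ => h.differentiable x) (fun x _ => h'.differentiable x)]
  simp only [mul_comm]

end IsTestFunction

end TestFunctions

section Polyhedra

variable {V ι : Type*} [NormedAddCommGroup V] [InnerProductSpace ℝ V] {ν : ι → V} {c : ι → ℝ}
  {i : ι} {x : V} {R : ℝ}

/-- The open polyhedron cut out by the half-spaces `⟪ν i, x⟫ < c i`. -/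
def polyhedron (ν : ι → V) (c : ι → ℝ) : Set V :=
  {x | ∀ i, inner ℝ (ν i) x < c i}

/-- The signed distance from `x` to the `i`-th face of `polyhedron ν c` (when `‖ν i‖ = 1`),
positive inside the polyhedron. -/
def faceDist (ν : ι → V) (c : ι → ℝ) (i : ι) (x : V) : ℝ :=
  c i - inner ℝ (ν i) x

/-- The points of a polyhedron whose nearest face is the `i`-th one, ties being broken by the
order of the faces. -/
def nearestFaceCell [LinearOrder ι] (ν : ι → V) (c : ι → ℝ) (i : ι) : Set V :=
  {x ∈ polyhedron ν c | ∀ j, toLex (faceDist ν c i x, i) ≤ toLex (faceDist ν c j x, j)}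

lemma isOpen_polyhedron [Finite ι] : IsOpen (polyhedron ν c) := by
  simp only [polyhedron, Set.ofPred_forall]
  exact isOpen_iInter_of_finite fun i =>
    isOpen_lt (continuous_const.inner continuous_id) continuous_const

lemma convex_polyhedron : Convex ℝ (polyhedron ν c) := by
  simp only [polyhedron, Set.ofPred_forall]
  exact convex_iInter fun i => convex_halfSpace_lt (innerSL ℝ (ν i)).isLinear _

lemma mem_polyhedron_iff_faceDist_pos : x ∈ polyhedron ν c ↔ ∀ i, 0 < faceDist ν c i x :=
  forall_congr' fun _ => sub_pos.symm

lemma continuous_faceDist : Continuous (faceDist ν c i) :=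
  continuous_const.sub (continuous_const.inner continuous_id)

lemma faceDist_add_smul_self (hν : ‖ν i‖ = 1) (x : V) (t : ℝ) :
    faceDist ν c i (x + t • ν i) = faceDist ν c i x - t := by
  rw [faceDist, faceDist, inner_add_right, inner_smul_right, real_inner_self_eq_norm_sq, hν]
  ring

lemma faceDist_sub_norm_le (hν : ‖ν i‖ = 1) (x y : V) :
    faceDist ν c i x - ‖y‖ ≤ faceDist ν c i (x + y) := by
  have := real_inner_le_norm (ν i) y
  rw [hν, one_mul] at this
  rw [faceDist, faceDist, inner_add_right]
  linarith

section NearestFaceCell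

variable [LinearOrder ι]

lemma faceDist_le_of_mem_nearestFaceCell (hx : x ∈ nearestFaceCell ν c i) (j : ι) :
    faceDist ν c i x ≤ faceDist ν c j x :=
  (Prod.Lex.toLex_le_toLex'.1 (hx.2 j)).1

lemma nearestFaceCell_subset : nearestFaceCell ν c i ⊆ polyhedron ν c :=
  Set.sep_subset _ _

lemma measurableSet_nearestFaceCell [Finite ι] [MeasurableSpace V] [BorelSpace V] (i : ι) :
    MeasurableSet (nearestFaceCell ν c i) := by
  have h_meas (j : ι) : Measurable (faceDist ν c j) := continuous_faceDist.measurable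
  refine isOpen_polyhedron.measurableSet.inter ?_
  change MeasurableSet {x | ∀ j, toLex (faceDist ν c i x, i) ≤ toLex (faceDist ν c j x, j)}
  simp only [Prod.Lex.toLex_le_toLex, Set.ofPred_forall]
  exact MeasurableSet.iInter fun j => (measurableSet_lt (h_meas i) (h_meas j)).union
    ((measurableSet_eq_fun (h_meas i) (h_meas j)).inter (MeasurableSet.const _))

lemma iUnion_nearestFaceCell [Finite ι] [Nonempty ι] :
    ⋃ i, nearestFaceCell ν c i = polyhedron ν c := by
  refine (Set.iUnion_subset fun i => nearestFaceCell_subset).antisymm fun x hx => ?_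
  obtain ⟨i, hi⟩ := Finite.exists_min fun i => toLex (faceDist ν c i x, i)
  exact Set.mem_iUnion.2 ⟨i, hx, hi⟩

lemma pairwise_disjoint_nearestFaceCell :
    Pairwise (Function.onFun Disjoint (nearestFaceCell ν c)) := fun i j hij =>
  Set.disjoint_left.2 fun _ hi hj =>
    hij (congrArg Prod.snd (toLex.injective ((hi.2 j).antisymm (hj.2 i))))

lemma add_smul_mem_nearestFaceCell (hν : ∀ i, ‖ν i‖ = 1) (hx : x ∈ nearestFaceCell ν c i)
    {s : ℝ} (hs : 0 ≤ s) (hs' : s < faceDist ν c i x) :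
    x + s • ν i ∈ nearestFaceCell ν c i := by
  have h_self := faceDist_add_smul_self (c := c) (hν i) x s
  have h_other (j : ι) : faceDist ν c j x - s ≤ faceDist ν c j (x + s • ν i) := by
    simpa [norm_smul, hν i, abs_of_nonneg hs] using
      faceDist_sub_norm_le (c := c) (hν j) x (s • ν i)
  refine ⟨mem_polyhedron_iff_faceDist_pos.2 fun j => ?_, fun j => ?_⟩
  · linarith [h_other j, faceDist_le_of_mem_nearestFaceCell hx j]
  · refine Prod.Lex.toLex_le_toLex.2 ?_
    rcases Prod.Lex.toLex_le_toLex.1 (hx.2 j) with h_lt | ⟨h_eq, hij⟩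
    · exact Or.inl (by linarith [h_other j])
    · refine (h_self.trans_le ?_).lt_or_eq.imp_right (⟨·, hij⟩)
      exact (congrArg (· - s) h_eq).trans_le (h_other j)

lemma ball_faceDist_subset_polyhedron (hν : ∀ i, ‖ν i‖ = 1) (hx : x ∈ nearestFaceCell ν c i) :
    Metric.ball x (faceDist ν c i x) ⊆ polyhedron ν c := fun y hy =>
  mem_polyhedron_iff_faceDist_pos.2 fun j => by
    have := faceDist_sub_norm_le (c := c) (hν j) x (y - x)
    rw [add_sub_cancel] at this
    rw [mem_ball_iff_norm] at hy
    linarith [faceDist_le_of_mem_nearestFaceCell hx j]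

lemma ae_eq_Ioc_of_Ico_subset {S : Set ℝ} {a b : ℝ} (hS : S.Nonempty) (h_sub : S ⊆ Set.Ico a b)
    (h_up : ∀ s ∈ S, Set.Ico s b ⊆ S) :
    ∃ a' ∈ Set.Icc a b, S =ᵐ[volume] Set.Ioc a' b := by
  have h_bdd : BddBelow S := ⟨a, fun t ht => (h_sub ht).1⟩
  have h_Ioo : Set.Ioo (sInf S) b ⊆ S := fun t ht => by
    obtain ⟨s, hs, hst⟩ := exists_lt_of_csInf_lt hS ht.1
    exact h_up s hs ⟨hst.le, ht.2⟩
  have h_Icc : S ⊆ Set.Icc (sInf S) b := fun t ht => ⟨csInf_le h_bdd ht, (h_sub ht).2.le⟩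
  refine ⟨sInf S, ⟨le_csInf hS fun t ht => (h_sub ht).1, ?_⟩, ?_⟩
  · obtain ⟨t, ht⟩ := hS
    exact (csInf_le h_bdd ht).trans (h_sub ht).2.le
  · exact ((LE.le.eventuallyLE h_Icc).trans Ioc_ae_eq_Icc.symm.le).antisymm
      (Ioo_ae_eq_Ioc.symm.le.trans (LE.le.eventuallyLE h_Ioo))

lemma line_nearestFaceCell_ae_eq_Ioc (hν : ∀ i, ‖ν i‖ = 1)
    (hR : ∀ x r, 0 < r → Metric.ball x r ⊆ polyhedron ν c → r ≤ R)
    (h_ne : {t : ℝ | x + t • ν i ∈ nearestFaceCell ν c i}.Nonempty) :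
    ∃ a ∈ Set.Icc (faceDist ν c i x - R) (faceDist ν c i x),
      {t : ℝ | x + t • ν i ∈ nearestFaceCell ν c i} =ᵐ[volume]
        Set.Ioc a (faceDist ν c i x) := by
  have h_dist (t : ℝ) := faceDist_add_smul_self (c := c) (hν i) x t
  refine ae_eq_Ioc_of_Ico_subset h_ne (fun t ht => ?_) fun s hs t ht => ?_
  · have h_pos := mem_polyhedron_iff_faceDist_pos.1 ht.1 i
    have h_le := hR _ _ h_pos (ball_faceDist_subset_polyhedron hν ht)
    rw [h_dist] at h_pos h_le
    constructor <;> linarith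
  · have := add_smul_mem_nearestFaceCell hν hs (sub_nonneg.2 ht.1) (by
      linarith [h_dist s, ht.2])
    rwa [add_assoc, ← add_smul, add_sub_cancel] at this

end NearestFaceCell

end Polyhedra

section PolyhedralApproximation

variable {V : Type*} [NormedAddCommGroup V] [InnerProductSpace ℝ V] {Ω K : Set V}

lemma exists_unit_separating [CompleteSpace V] (ho : IsOpen Ω) (hconv : Convex ℝ Ω)
    (hK : IsCompact K) (hK_ne : K.Nonempty) (hKΩ : K ⊆ Ω) {z : V} (hz : z ∉ Ω) :
    ∃ (ν : V) (c : ℝ), ‖ν‖ = 1 ∧ (∀ x ∈ K, inner ℝ ν x < c) ∧ c < inner ℝ ν z := by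
  obtain ⟨f, hf⟩ := geometric_hahn_banach_open_point hconv ho hz
  obtain ⟨v, rfl⟩ := (InnerProductSpace.toDual ℝ V).surjective f
  simp only [InnerProductSpace.toDual_apply_apply] at hf
  obtain ⟨m, hmK, h_max⟩ := hK.exists_isMaxOn hK_ne
    (f := fun x => inner ℝ v x) (by fun_prop)
  have hmz := hf m (hKΩ hmK)
  have hv : 0 < ‖v‖ := norm_pos_iff.2 (by rintro rfl; simp at hmz)
  refine ⟨‖v‖⁻¹ • v, ‖v‖⁻¹ * ((inner ℝ v m + inner ℝ v z) / 2), ?_, fun x hx => ?_, ?_⟩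
  · rw [norm_smul, norm_inv, norm_norm, inv_mul_cancel₀ hv.ne']
  · rw [real_inner_smul_left]
    have : inner ℝ v x ≤ inner ℝ v m := h_max hx
    gcongr
    linarith
  · rw [real_inner_smul_left]
    gcongr
    linarith

lemma subset_of_isPreconnected_of_disjoint_frontier {X : Type*} [TopologicalSpace X] {P Ω : Set X}
    (hP : IsPreconnected P) (ho : IsOpen Ω) (h_disj : Disjoint P (frontier Ω))
    (h_ne : (P ∩ Ω).Nonempty) : P ⊆ Ω := by
  rw [ho.frontier_eq] at h_disj
  refine hP.subset_left_of_subset_union ho isClosed_closure.isOpen_compl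
    (disjoint_compl_right.mono_left subset_closure) (fun x hx => ?_) h_ne
  exact or_iff_not_imp_left.2 fun hxΩ hx_cl => Set.disjoint_left.1 h_disj hx ⟨hx_cl, hxΩ⟩

lemma exists_polyhedron_between [ProperSpace V] [Nontrivial V] (ho : IsOpen Ω)
    (hb : Bornology.IsBounded Ω) (hconv : Convex ℝ Ω) (hK : IsCompact K) (hK_ne : K.Nonempty)
    (hKΩ : K ⊆ Ω) :
    ∃ (n : ℕ) (_ : Nonempty (Fin n)) (ν : Fin n → V) (c : Fin n → ℝ), (∀ i, ‖ν i‖ = 1) ∧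
      K ⊆ polyhedron ν c ∧ polyhedron ν c ⊆ Ω := by
  have : CompleteSpace V := inferInstance
  have h_sep (z : frontier Ω) := exists_unit_separating ho hconv hK hK_ne hKΩ
    (ho.frontier_eq ▸ z.2 : (z : V) ∈ closure Ω \ Ω).2
  choose ν c hν hKc hz using h_sep
  have h_compact : IsCompact (frontier Ω) := Metric.isCompact_of_isClosed_isBounded
    isClosed_frontier (hb.closure.subset frontier_subset_closure)
  obtain ⟨s, hs⟩ := h_compact.elim_finite_subcover
    (fun z : frontier Ω => {x : V | c z < inner ℝ (ν z) x})
    (fun z => isOpen_lt continuous_const (continuous_const.inner continuous_id))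
    (fun z hz' => Set.mem_iUnion.2 ⟨⟨z, hz'⟩, hz ⟨z, hz'⟩⟩)
  have h_frontier : (frontier Ω).Nonempty := nonempty_frontier_iff.2 ⟨hK_ne.mono hKΩ, fun h => by
    rw [h] at hb
    exact NoncompactSpace.noncompact_univ (X := V)
      (Metric.isCompact_of_isClosed_isBounded isClosed_univ hb)⟩
  have hs_cover : ∀ x ∈ frontier Ω, ∃ z ∈ s, c z < inner ℝ (ν z) x := fun x hx => by
    simpa using hs hx
  have hs_ne : s.Nonempty := by
    obtain ⟨x, hx⟩ := h_frontier
    obtain ⟨z, hz, -⟩ := hs_cover x hx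
    exact ⟨z, hz⟩
  let e := s.equivFin
  refine ⟨s.card, e.symm.nonempty_congr.2 hs_ne.to_subtype, fun i => ν (e.symm i),
    fun i => c (e.symm i), fun i => hν _, fun x hx i => hKc _ x hx, ?_⟩
  refine subset_of_isPreconnected_of_disjoint_frontier convex_polyhedron.isPreconnected ho
    (Set.disjoint_left.2 fun x hxP hx => ?_) (hK_ne.mono fun x hx => ⟨fun i => hKc _ x hx, hKΩ hx⟩)
  obtain ⟨z, hz, hxz⟩ := hs_cover x hx
  have := hxP (e ⟨z, hz⟩)
  simp only [Equiv.symm_apply_apply] at this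
  exact lt_asymm this hxz

end PolyhedralApproximation

section Inradius

variable {D : ℕ} [NeZero D] {Ω : Set (E D)}

lemma le_inradius (hb : Bornology.IsBounded Ω) {x : E D} {r : ℝ} (hr : 0 < r)
    (h : Metric.ball x r ⊆ Ω) : r ≤ inradius Ω := by
  refine le_csSup ⟨Metric.diam Ω, ?_⟩ ⟨hr, x, h⟩
  rintro s ⟨hs, y, hy⟩
  have := Metric.diam_mono hy hb
  rw [Metric.diam_ball_eq y hs.le] at this
  linarith

lemma inradius_pos (hΩ : Ω ∈ convexDomains D) : 0 < inradius Ω := by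
  obtain ⟨x, hx⟩ := hΩ.2.2.2
  obtain ⟨r, hr, h⟩ := Metric.isOpen_iff.1 hΩ.1 x hx
  exact hr.trans_le (le_inradius hΩ.2.1 hr h)

end Inradius

section Makai

variable {D : ℕ} {Ω : Set (E D)} {p q R : ℝ} {φ : E D → ℝ}

/-- The concave functional `∫ φ - (1/p) ∫ |∇φ|^p` maximised by the `p`-torsion function. -/
noncomputable def energy (p : ℝ) (φ : E D → ℝ) : ℝ :=
  (∫ x, φ x) - (1 / p) * ∫ x, ‖gradient φ x‖ ^ p

lemma IsTestFunction.integrable_energy_density (h : IsTestFunction Ω φ) (hp : 0 < p) :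
    Integrable fun x => φ x - 1 / p * ‖gradient φ x‖ ^ p :=
  (h.integrable volume).sub ((h.integrable_norm_gradient_rpow volume hp).const_mul _)

lemma IsTestFunction.energy_eq_setIntegral (h : IsTestFunction Ω φ) (hp : 0 < p) :
    energy p φ = ∫ x in Ω, (φ x - 1 / p * ‖gradient φ x‖ ^ p) := by
  rw [integral_sub (h.integrable _) ((h.integrable_norm_gradient_rpow _ hp).const_mul _),
    integral_const_mul, h.setIntegral_eq, h.setIntegral_norm_gradient_rpow_eq hp.ne', energy]

variable {ι : Type*} [Finite ι] [LinearOrder ι] {ν : ι → E D} {c : ι → ℝ}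

lemma setIntegral_nearestFaceCell_le (hpq : p.HolderConjugate q) (hν : ∀ i, ‖ν i‖ = 1)
    (hR : ∀ x r, 0 < r → Metric.ball x r ⊆ polyhedron ν c → r ≤ R)
    (hb : Bornology.IsBounded (polyhedron ν c)) (h : IsTestFunction (polyhedron ν c) φ) (i : ι) :
    ∫ x in nearestFaceCell ν c i,
      (φ x - 1 / p * ‖gradient φ x‖ ^ p - R ^ q / (q * (q + 1))) ≤ 0 := by
  let A := nearestFaceCell ν c i
  let F : E D → ℝ := fun x => φ x - 1 / p * ‖gradient φ x‖ ^ p - R ^ q / (q * (q + 1))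
  have hA : MeasurableSet A := measurableSet_nearestFaceCell i
  have hF : IntegrableOn F A := (h.integrable_energy_density hpq.pos).integrableOn.sub
    (integrableOn_const (hb.subset nearestFaceCell_subset).measure_lt_top.ne)
  rw [← integral_indicator hA]
  refine integral_nonpos_of_line_integral_nonpos ((integrable_indicator_iff hA).2 hF)
    (norm_ne_zero_iff.1 ((hν i).trans_ne one_ne_zero)) fun x => ?_
  have h_line : Continuous fun t : ℝ => x + t • ν i := by fun_prop
  have h_density : Continuous fun t : ℝ =>
      φ (x + t • ν i) - 1 / p * ‖gradient φ (x + t • ν i)‖ ^ p :=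
    (h.continuous.comp h_line).sub
      ((continuous_norm_rpow (h.continuous_gradient.comp h_line) hpq.nonneg).const_mul _)
  change ∫ t, ((fun t => x + t • ν i) ⁻¹' A).indicator (fun t => F (x + t • ν i)) t ≤ 0
  rw [integral_indicator (hA.preimage h_line.measurable)]
  rcases ((fun t : ℝ => x + t • ν i) ⁻¹' A).eq_empty_or_nonempty with h_empty | h_ne
  · simp [h_empty]
  obtain ⟨a, ⟨h_low, h_high⟩, h_ae⟩ := line_nearestFaceCell_ae_eq_Ioc hν hR h_ne
  have h_end : φ (x + faceDist ν c i x • ν i) = 0 := h.eq_zero fun h_mem => by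
    have := mem_polyhedron_iff_faceDist_pos.1 h_mem i
    rw [faceDist_add_smul_self (hν i), sub_self] at this
    exact this.false
  rw [setIntegral_congr_set (s := (fun t : ℝ => x + t • ν i) ⁻¹' A) h_ae,
    ← intervalIntegral.integral_of_le h_high,
    intervalIntegral.integral_sub (h_density.intervalIntegrable _ _) intervalIntegrable_const]
  exact sub_nonpos.2 (intervalIntegral_line_energy_le hpq h.contDiff_one (hν i).le h_high
    (by linarith) h_end)

lemma energy_le_of_polyhedron [Nonempty ι] (hpq : p.HolderConjugate q) (hν : ∀ i, ‖ν i‖ = 1)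
    (hR : ∀ x r, 0 < r → Metric.ball x r ⊆ polyhedron ν c → r ≤ R)
    (hb : Bornology.IsBounded (polyhedron ν c)) (h : IsTestFunction (polyhedron ν c) φ) :
    energy p φ ≤ R ^ q / (q * (q + 1)) * volume.real (polyhedron ν c) := by
  have := Fintype.ofFinite ι
  have h_int := h.integrable_energy_density hpq.pos
  have h_int_sub : IntegrableOn (fun x => φ x - 1 / p * ‖gradient φ x‖ ^ p -
      R ^ q / (q * (q + 1))) (polyhedron ν c) :=
    h_int.integrableOn.sub (integrableOn_const hb.measure_lt_top.ne)
  have h_cells : ∫ x in polyhedron ν c,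
      (φ x - 1 / p * ‖gradient φ x‖ ^ p - R ^ q / (q * (q + 1))) ≤ 0 := by
    rw [← iUnion_nearestFaceCell, integral_iUnion_fintype measurableSet_nearestFaceCell
      pairwise_disjoint_nearestFaceCell fun i => h_int_sub.mono_set nearestFaceCell_subset]
    exact Finset.sum_nonpos fun i _ => setIntegral_nearestFaceCell_le hpq hν hR hb h i
  rwa [integral_sub h_int.integrableOn (integrableOn_const hb.measure_lt_top.ne), sub_nonpos,
    ← h.energy_eq_setIntegral hpq.pos, setIntegral_const, smul_eq_mul, mul_comm] at h_cells

theorem energy_le_makai [NeZero D] (hpq : p.HolderConjugate q) (hΩ : Ω ∈ convexDomains D)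
    (h : IsTestFunction Ω φ) :
    energy p φ ≤ inradius Ω ^ q / (q * (q + 1)) * volume.real Ω := by
  have hq := hpq.symm.pos
  have h_inradius := inradius_pos hΩ
  obtain ⟨x₀, hx₀⟩ := hΩ.2.2.2
  obtain ⟨n, hn, ν, c, hν, hKP, hPΩ⟩ := exists_polyhedron_between hΩ.1 hΩ.2.1 hΩ.2.2.1
    (h.2.1.isCompact.insert x₀) (Set.insert_nonempty _ _) (Set.insert_subset hx₀ h.2.2)
  calc energy p φ ≤ inradius Ω ^ q / (q * (q + 1)) * volume.real (polyhedron ν c) :=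
        energy_le_of_polyhedron hpq hν
          (fun x r hr hx => le_inradius hΩ.2.1 hr (hx.trans hPΩ)) (hΩ.2.1.subset hPΩ)
          ⟨h.1, h.2.1, (Set.subset_insert _ _).trans hKP⟩
    _ ≤ inradius Ω ^ q / (q * (q + 1)) * volume.real Ω :=
        mul_le_mul_of_nonneg_left (measureReal_mono hPΩ hΩ.2.1.measure_lt_top.ne) (by positivity)

end Makai

section LpConvergence

variable {α ι F : Type*} [MeasurableSpace α] {μ : Measure α} [NormedAddCommGroup F] {p q : ℝ}
  {l : Filter ι}

lemma fact_one_le_ofReal (hp : 1 ≤ p) : Fact (1 ≤ ENNReal.ofReal p) :=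
  ⟨ENNReal.one_le_ofReal.2 hp⟩

lemma norm_toLp_rpow (hp : 0 < p) {f : α → F} (hf : MemLp f (ENNReal.ofReal p) μ) :
    ‖hf.toLp f‖ ^ p = ∫ x, ‖f x‖ ^ p ∂μ := by
  have h_nonneg : 0 ≤ ∫ x, ‖f x‖ ^ p ∂μ := integral_nonneg fun x => by positivity
  rw [Lp.norm_toLp, hf.eLpNorm_eq_integral_rpow_norm (by simpa using hp) (by simp),
    ENNReal.toReal_ofReal hp.le, ENNReal.toReal_ofReal (by positivity),
    Real.rpow_inv_rpow h_nonneg hp.ne']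

lemma integrable_norm_rpow_of_memLp (hp : 0 < p) {f : α → F}
    (hf : MemLp f (ENNReal.ofReal p) μ) : Integrable (fun x => ‖f x‖ ^ p) μ := by
  simpa [ENNReal.toReal_ofReal hp.le] using hf.integrable_norm_rpow (by simpa using hp) (by simp)

lemma tendsto_integral_norm_rpow (hp : 1 ≤ p) {f : ι → α → F} {g : α → F}
    (hf : ∀ n, MemLp (f n) (ENNReal.ofReal p) μ) (hg : MemLp g (ENNReal.ofReal p) μ)
    (h : Tendsto (fun n => eLpNorm (fun x => g x - f n x) (ENNReal.ofReal p) μ) l (𝓝 0)) :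
    Tendsto (fun n => ∫ x, ‖f n x‖ ^ p ∂μ) l (𝓝 (∫ x, ‖g x‖ ^ p ∂μ)) := by
  have := fact_one_le_ofReal hp
  have hp₀ : 0 < p := zero_lt_one.trans_le hp
  have h_toLp : Tendsto (fun n => (hf n).toLp (f n)) l (𝓝 (hg.toLp g)) :=
    (Lp.tendsto_Lp_iff_tendsto_eLpNorm'' f hf g hg).2
      (h.congr fun n => eLpNorm_sub_comm g (f n) _ _)
  simpa only [norm_toLp_rpow hp₀] using h_toLp.norm.rpow_const (p := p) (Or.inr hp₀.le)

lemma exists_memLp_tendsto_of_cauchy [CompleteSpace F] (hp : 1 ≤ p) {f : ℕ → α → F}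
    (hf : ∀ n, MemLp (f n) (ENNReal.ofReal p) μ)
    (h : ∀ ε > 0, ∃ N, ∀ m ≥ N, ∀ n ≥ N, ∫ x, ‖f m x - f n x‖ ^ p ∂μ < ε) :
    ∃ g : α → F, MemLp g (ENNReal.ofReal p) μ ∧
      Tendsto (fun n => eLpNorm (fun x => g x - f n x) (ENNReal.ofReal p) μ) atTop (𝓝 0) := by
  have := fact_one_le_ofReal hp
  have hp₀ : 0 < p := zero_lt_one.trans_le hp
  have h_cauchy : CauchySeq fun n => (hf n).toLp (f n) := by
    refine Metric.cauchySeq_iff.2 fun ε hε => ?_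
    obtain ⟨N, hN⟩ := h (ε ^ p) (by positivity)
    refine ⟨N, fun m hm n hn => ?_⟩
    rw [dist_eq_norm, ← MemLp.toLp_sub, ← Real.rpow_lt_rpow_iff (norm_nonneg _) hε.le hp₀,
      norm_toLp_rpow hp₀]
    exact hN m hm n hn
  obtain ⟨g, hg⟩ := cauchySeq_tendsto_of_complete h_cauchy
  rw [← Lp.toLp_coeFn g (Lp.memLp g), Lp.tendsto_Lp_iff_tendsto_eLpNorm'' f hf] at hg
  exact ⟨g, Lp.memLp g, hg.congr fun n => eLpNorm_sub_comm (f n) g _ _⟩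

variable {G H : Type*} [NormedAddCommGroup G] [NormedAddCommGroup H]
  [NormedSpace ℝ F] [NormedSpace ℝ G] [NormedSpace ℝ H]

lemma integrable_bilin_of_memLp (hpq : p.HolderConjugate q) (B : F →L[ℝ] G →L[ℝ] H) {u : α → F}
    {k : α → G} (hu : MemLp u (ENNReal.ofReal p) μ) (hk : MemLp k (ENNReal.ofReal q) μ) :
    Integrable (fun x => B (u x) (k x)) μ := by
  have := hpq.ennrealOfReal
  exact memLp_one_iff_integrable.1 (MemLp.of_bilin (r := 1) (fun a b => B a b) ‖B‖₊ hu hk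
    (B.aestronglyMeasurable_comp₂ hu.1 hk.1) (ae_of_all _ fun x => B.le_opNorm₂ _ _))

lemma tendsto_integral_bilin (hpq : p.HolderConjugate q) (B : F →L[ℝ] G →L[ℝ] H)
    {f : ι → α → F} {g : α → F} {k : α → G}
    (hf : ∀ n, MemLp (f n) (ENNReal.ofReal p) μ) (hg : MemLp g (ENNReal.ofReal p) μ)
    (hk : MemLp k (ENNReal.ofReal q) μ)
    (h : Tendsto (fun n => eLpNorm (fun x => g x - f n x) (ENNReal.ofReal p) μ) l (𝓝 0)) :
    Tendsto (fun n => ∫ x, B (f n x) (k x) ∂μ) l (𝓝 (∫ x, B (g x) (k x) ∂μ)) := by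
  have := hpq.ennrealOfReal
  refine tendsto_integral_of_L1' _ (integrable_bilin_of_memLp hpq B hg hk).1
    (Eventually.of_forall fun n => integrable_bilin_of_memLp hpq B (hf n) hk) ?_
  have h_holder (n : ι) : eLpNorm ((fun x => B (f n x) (k x)) - fun x => B (g x) (k x)) 1 μ ≤
      ‖B‖₊ * eLpNorm (fun x => g x - f n x) (ENNReal.ofReal p) μ *
        eLpNorm k (ENNReal.ofReal q) μ := by
    rw [eLpNorm_sub_comm]
    refine le_of_eq_of_le ?_ (eLpNorm_le_eLpNorm_mul_eLpNorm'_of_norm (p := ENNReal.ofReal p)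
      (q := ENNReal.ofReal q) (r := 1) (hg.sub (hf n)).1 hk.1 (fun a b => B a b) ‖B‖₊
      (ae_of_all _ fun x => B.le_opNorm₂ _ _))
    congr 1 with x
    simp
  have h_zero := ENNReal.Tendsto.mul_const (ENNReal.Tendsto.const_mul (a := (‖B‖₊ : ENNReal)) h
    (Or.inr ENNReal.coe_ne_top)) (b := eLpNorm k (ENNReal.ofReal q) μ) (Or.inr hk.2.ne)
  exact tendsto_of_tendsto_of_tendsto_of_le_of_le tendsto_const_nhds (by simpa using h_zero)
    (fun _ => zero_le) h_holder

end LpConvergence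

section Poincare

variable {D : ℕ} {p M : ℝ} {Ω : Set (E D)} {φ : E D → ℝ} {c : E D}

lemma IsTestFunction.line_integral_poincare_nonpos (h : IsTestFunction Ω φ) (hp : 1 ≤ p)
    (hM : 0 ≤ M) (hΩ : Ω ⊆ Metric.ball c M) {v : E D} (hv : ‖v‖ = 1) (x : E D) :
    ∫ t : ℝ, (‖φ (x + t • v)‖ ^ p - (2 * M) ^ p * ‖gradient φ (x + t • v)‖ ^ p) ≤ 0 := by
  have hp₀ : 0 < p := zero_lt_one.trans_le hp
  set a := -inner ℝ v (x - c) - M with ha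
  set b := -inner ℝ v (x - c) + M with hb
  have hab : a ≤ b := by linarith
  have h_outside (t : ℝ) (ht : t ∉ Set.Ioo a b) : x + t • v ∉ Ω := fun h_mem => ht <| by
    have h_inner : inner ℝ v (x + t • v - c) = inner ℝ v (x - c) + t := by
      rw [add_sub_right_comm, inner_add_right, inner_smul_right, real_inner_self_eq_norm_sq, hv]
      ring
    have h_dist : |inner ℝ v (x - c) + t| < M := by
      rw [← h_inner]
      refine (abs_real_inner_le_norm _ _).trans_lt ?_
      simpa [hv] using mem_ball_iff_norm.1 (hΩ h_mem)
    constructor <;> linarith [abs_lt.1 h_dist]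
  have h_line : Continuous fun t : ℝ => x + t • v := by fun_prop
  have h_int : IntervalIntegrable (fun t => ‖φ (x + t • v)‖ ^ p) volume a b :=
    (continuous_norm_rpow (h.continuous.comp h_line) hp₀.le).intervalIntegrable _ _
  have h_int_grad : IntervalIntegrable (fun t => ‖gradient φ (x + t • v)‖ ^ p) volume a b :=
    (continuous_norm_rpow (h.continuous_gradient.comp h_line) hp₀.le).intervalIntegrable _ _
  rw [← setIntegral_eq_integral_of_forall_compl_eq_zero (s := Set.Ioc a b) fun t ht => ?_,
    ← intervalIntegral.integral_of_le hab,
    intervalIntegral.integral_sub h_int (h_int_grad.const_mul _),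
    intervalIntegral.integral_const_mul, sub_nonpos]
  · have h_length : b - a = 2 * M := by rw [ha, hb]; ring
    rw [← h_length]
    exact intervalIntegral_line_poincare hp h.contDiff_one hv.le hab
      (h.eq_zero (h_outside a fun h_mem => h_mem.1.false))
  · have h_notMem := h_outside t fun h_mem => ht (Set.Ioo_subset_Ioc_self h_mem)
    simp [h.eq_zero h_notMem, h.gradient_eq_zero h_notMem, Real.zero_rpow hp₀.ne']

lemma IsTestFunction.poincare [NeZero D] (h : IsTestFunction Ω φ) (hp : 1 ≤ p) (hM : 0 ≤ M)
    (hΩ : Ω ⊆ Metric.ball c M) :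
    ∫ x, ‖φ x‖ ^ p ≤ (2 * M) ^ p * ∫ x, ‖gradient φ x‖ ^ p := by
  have hp₀ : 0 < p := zero_lt_one.trans_le hp
  obtain ⟨v, hv⟩ := exists_norm_eq (E D) zero_le_one
  have h_grad := (h.integrable_norm_gradient_rpow volume hp₀).const_mul ((2 * M) ^ p)
  rw [← integral_const_mul, ← sub_nonpos, ← integral_sub (h.integrable_norm_rpow volume hp₀) h_grad]
  exact integral_nonpos_of_line_integral_nonpos ((h.integrable_norm_rpow volume hp₀).sub h_grad)
    (norm_ne_zero_iff.1 (hv.trans_ne one_ne_zero)) (h.line_integral_poincare_nonpos hp hM hΩ hv)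

end Poincare

section PFlux

variable {V α : Type*} [NormedAddCommGroup V] [InnerProductSpace ℝ V] [MeasurableSpace α]
  {μ : Measure α} {p q : ℝ} {G H : α → V}

/-- The nonlinearity `|v|^{p-2} v` of the `p`-Laplacian. -/
noncomputable def pFlux (p : ℝ) (v : V) : V := ‖v‖ ^ (p - 2) • v

lemma norm_pFlux (hp : 1 < p) (v : V) : ‖pFlux p v‖ = ‖v‖ ^ (p - 1) := by
  rw [pFlux, norm_smul, Real.norm_of_nonneg (by positivity),
    ← Real.rpow_add_one' (norm_nonneg _) (by linarith)]
  congr 1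
  ring

lemma norm_pFlux_rpow (hpq : p.HolderConjugate q) (v : V) : ‖pFlux p v‖ ^ q = ‖v‖ ^ p := by
  rw [norm_pFlux hpq.lt, ← Real.rpow_mul (norm_nonneg _), hpq.sub_one_mul_conj]

lemma inner_pFlux_self (hp : 1 < p) (v : V) : inner ℝ (pFlux p v) v = ‖v‖ ^ p := by
  rw [pFlux, real_inner_smul_left, real_inner_self_eq_norm_sq, ← Real.rpow_natCast,
    ← Real.rpow_add' (norm_nonneg _) (by push_cast; linarith)]
  congr 1
  push_cast
  ring

lemma aestronglyMeasurable_pFlux (hG : AEStronglyMeasurable G μ) :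
    AEStronglyMeasurable (fun x => pFlux p (G x)) μ :=
  (hG.norm.aemeasurable.pow_const _).aestronglyMeasurable.smul hG

lemma memLp_pFlux (hpq : p.HolderConjugate q) (hG : MemLp G (ENNReal.ofReal p) μ) :
    MemLp (fun x => pFlux p (G x)) (ENNReal.ofReal q) μ := by
  refine (integrable_norm_rpow_iff (aestronglyMeasurable_pFlux hG.1)
    (by simpa using hpq.symm.pos) (by simp)).1 ?_
  simpa only [ENNReal.toReal_ofReal hpq.symm.nonneg, norm_pFlux_rpow hpq] using
    integrable_norm_rpow_of_memLp hpq.pos hG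

lemma integral_inner_pFlux_le (hpq : p.HolderConjugate q) (hG : MemLp G (ENNReal.ofReal p) μ)
    (hH : MemLp H (ENNReal.ofReal p) μ) :
    ∫ x, inner ℝ (pFlux p (G x)) (H x) ∂μ ≤
      (∫ x, ‖G x‖ ^ p ∂μ) / q + (∫ x, ‖H x‖ ^ p ∂μ) / p := by
  have h_int := (integrable_norm_rpow_of_memLp hpq.pos hG).div_const q
  have h_int' := (integrable_norm_rpow_of_memLp hpq.pos hH).div_const p
  rw [← integral_div, ← integral_div, ← integral_add h_int h_int']
  refine integral_mono (integrable_bilin_of_memLp hpq.symm (innerSL ℝ) (memLp_pFlux hpq hG) hH)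
    (h_int.add h_int') fun x => ?_
  simpa only [norm_pFlux_rpow hpq] using (real_inner_le_norm (pFlux p (G x)) (H x)).trans
    (Real.young_inequality_of_nonneg (norm_nonneg _) (norm_nonneg _) hpq.symm)

lemma hasDerivAt_norm_add_smul_rpow (hp : 1 < p) (v w : V) (t : ℝ) :
    HasDerivAt (fun t : ℝ => ‖v + t • w‖ ^ p) (p * inner ℝ (pFlux p (v + t • w)) w) t := by
  have h_line : HasDerivAt (fun t : ℝ => v + t • w) w t := by
    simpa using ((hasDerivAt_id t).smul_const w).const_add v
  refine ((hasFDerivAt_norm_rpow (v + t • w) hp).comp_hasDerivAt t h_line).congr_deriv ?_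
  simp only [pFlux, real_inner_smul_left, smul_apply, innerSL_apply_apply, smul_eq_mul, mul_assoc]

lemma abs_inner_pFlux_add_smul_le (hp : 1 < p) (v w : V) {t : ℝ} (ht : |t| ≤ 1) :
    |inner ℝ (pFlux p (v + t • w)) w| ≤ (‖v‖ + ‖w‖) ^ p := by
  have h_norm : ‖v + t • w‖ ≤ ‖v‖ + ‖w‖ := (norm_add_le _ _).trans <| by
    rw [norm_smul]
    gcongr
    exact mul_le_of_le_one_left (norm_nonneg _) ht
  calc |inner ℝ (pFlux p (v + t • w)) w| ≤ ‖v + t • w‖ ^ (p - 1) * ‖w‖ := by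
        simpa only [norm_pFlux hp] using abs_real_inner_le_norm (pFlux p (v + t • w)) w
    _ ≤ (‖v‖ + ‖w‖) ^ (p - 1) * (‖v‖ + ‖w‖) := by
        gcongr
        exact le_add_of_nonneg_left (norm_nonneg v)
    _ = (‖v‖ + ‖w‖) ^ p := by
        rw [← Real.rpow_add_one' (by positivity) (by linarith), sub_add_cancel]

lemma hasDerivAt_integral_norm_rpow (hp : 1 < p) (hG : MemLp G (ENNReal.ofReal p) μ)
    (hH : MemLp H (ENNReal.ofReal p) μ) :
    HasDerivAt (fun t : ℝ => ∫ x, ‖G x + t • H x‖ ^ p ∂μ)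
      (p * ∫ x, inner ℝ (pFlux p (G x)) (H x) ∂μ) 0 := by
  have hp₀ : 0 < p := zero_lt_one.trans hp
  have h_meas (t : ℝ) : AEStronglyMeasurable (fun x => G x + t • H x) μ :=
    hG.1.add (hH.1.const_smul t)
  have h_bound := integrable_norm_rpow_of_memLp hp₀ (hG.norm.add hH.norm)
  have h_deriv := (hasDerivAt_integral_of_dominated_loc_of_deriv_le (μ := μ) (x₀ := (0 : ℝ))
    (F := fun t x => ‖G x + t • H x‖ ^ p)
    (F' := fun t x => p * inner ℝ (pFlux p (G x + t • H x)) (H x))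
    (bound := fun x => p * (‖G x‖ + ‖H x‖) ^ p) (Metric.ball_mem_nhds 0 one_pos)
    (Eventually.of_forall fun t =>
      (Real.continuous_rpow_const hp₀.le).comp_aestronglyMeasurable (h_meas t).norm)
    (by simpa using integrable_norm_rpow_of_memLp hp₀ hG)
    (((aestronglyMeasurable_pFlux (h_meas 0)).inner hH.1).const_mul p)
    (ae_of_all _ fun x t ht => ?_)
    ((h_bound.const_mul p).congr (ae_of_all _ fun x => ?_))
    (ae_of_all _ fun x t _ => hasDerivAt_norm_add_smul_rpow hp (G x) (H x) t)).2
  · simpa only [zero_smul, add_zero, integral_const_mul] using h_deriv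
  · rw [norm_mul, Real.norm_of_nonneg hp₀.le]
    gcongr
    exact abs_inner_pFlux_add_smul_le hp _ _ (by simpa using (mem_ball_zero_iff.1 ht).le)
  · simp only [Pi.add_apply]
    rw [Real.norm_of_nonneg (by positivity)]

end PFlux

section MaximizingSequences

variable {D : ℕ} {Ω : Set (E D)} {p q δ : ℝ} {φ ψ : E D → ℝ}

/-- The values of the energy on the test functions of `Ω`. -/
def energies (p : ℝ) (Ω : Set (E D)) : Set ℝ := energy p '' {φ | IsTestFunction Ω φ}

lemma energy_zero (hp : p ≠ 0) : energy p (0 : E D → ℝ) = 0 := by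
  have h_grad (x : E D) : gradient (0 : E D → ℝ) x = 0 := by simp [gradient]
  simp [energy, h_grad, Real.zero_rpow hp]

lemma energies_nonempty (p : ℝ) (Ω : Set (E D)) : (energies p Ω).Nonempty :=
  ⟨_, 0, IsTestFunction.zero Ω, rfl⟩

lemma bddAbove_energies [NeZero D] (hp : 1 < p) (hΩ : Ω ∈ convexDomains D) :
    BddAbove (energies p Ω) :=
  ⟨_, Set.forall_mem_image.2 fun _ hφ =>
    energy_le_makai (Real.HolderConjugate.conjExponent hp) hΩ hφ⟩

lemma IsTestFunction.energy_le_sSup (h : IsTestFunction Ω φ) (hbdd : BddAbove (energies p Ω)) :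
    energy p φ ≤ sSup (energies p Ω) :=
  le_csSup hbdd ⟨φ, h, rfl⟩

lemma IsTestFunction.energy_const_mul (h : IsTestFunction Ω φ) {c : ℝ} (hc : 0 ≤ c) :
    energy p (fun x => c * φ x) =
      c * (∫ x, φ x) - 1 / p * (c ^ p * ∫ x, ‖gradient φ x‖ ^ p) := by
  simp only [energy, h.gradient_const_mul, norm_smul_rpow hc, integral_const_mul]

-- Compare `φ` with `φ / 2`: the gradient term shrinks by the factor `2 ^ p > 2`.
lemma exists_integral_norm_gradient_rpow_le (hp : 1 < p) (hbdd : BddAbove (energies p Ω)) :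
    ∃ B : ℝ, 0 < B ∧ ∀ φ, IsTestFunction Ω φ → sSup (energies p Ω) - 1 ≤ energy p φ →
      ∫ x, ‖gradient φ x‖ ^ p ≤ B := by
  have hp₀ : 0 < p := zero_lt_one.trans hp
  set M := sSup (energies p Ω)
  have hM : 0 ≤ M := by
    simpa only [energy_zero hp₀.ne'] using (IsTestFunction.zero Ω).energy_le_sSup hbdd
  have h_half : 0 < 1 / 2 - (1 / 2 : ℝ) ^ p :=
    sub_pos.2 (by simpa using
      Real.rpow_lt_rpow_of_exponent_gt (x := 1 / 2) (by norm_num) (by norm_num) hp)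
  refine ⟨p * ((M + 1) / (1 / 2 - (1 / 2) ^ p)), by positivity, fun φ h hφ => ?_⟩
  have h_scaled : energy p (fun x => 1 / 2 * φ x) ≤ M := (h.const_mul _).energy_le_sSup hbdd
  rw [h.energy_const_mul (by norm_num)] at h_scaled
  rw [← div_le_iff₀' hp₀, le_div_iff₀ h_half]
  rw [energy] at hφ
  generalize (1 / 2 : ℝ) ^ p = c at *
  linear_combination h_scaled + 1 / 2 * hφ + 1 / 2 * hM

lemma IsTestFunction.energy_midpoint (h : IsTestFunction Ω φ) (h' : IsTestFunction Ω ψ)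
    (hp : 0 < p) :
    energy p (fun x => 1 / 2 * (φ x + ψ x)) = (energy p φ + energy p ψ) / 2 +
      1 / p * ∫ x, midpointGap p (gradient φ x) (gradient ψ x) := by
  have h_mid := (h.add h').const_mul (1 / 2)
  have h_grad (x : E D) : gradient (fun x => 1 / 2 * (φ x + ψ x)) x =
      (1 / 2 : ℝ) • (gradient φ x + gradient ψ x) := by
    rw [(h.add h').gradient_const_mul, h.gradient_add h']
  have h_int := h.integrable_norm_gradient_rpow volume hp
  have h_int' := h'.integrable_norm_gradient_rpow volume hp
  have h_int_mid := h_mid.integrable_norm_gradient_rpow volume hp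
  have h_int_add : Integrable fun x => ‖gradient φ x‖ ^ p + ‖gradient ψ x‖ ^ p := h_int.add h_int'
  simp only [h_grad] at h_int_mid
  simp only [energy, midpointGap, h_grad]
  rw [integral_const_mul, integral_add (h.integrable volume) (h'.integrable volume),
    integral_sub (h_int_add.div_const 2) h_int_mid, integral_div, integral_add h_int h_int']
  ring

lemma IsTestFunction.integral_midpointGap_gradient_le (h : IsTestFunction Ω φ)
    (h' : IsTestFunction Ω ψ) (hp : 0 < p) (hbdd : BddAbove (energies p Ω))
    (hφ : sSup (energies p Ω) - δ ≤ energy p φ) (hψ : sSup (energies p Ω) - δ ≤ energy p ψ) :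
    ∫ x, midpointGap p (gradient φ x) (gradient ψ x) ≤ p * δ := by
  have h_mid := ((h.add h').const_mul (1 / 2)).energy_le_sSup hbdd
  rw [h.energy_midpoint h' hp, one_div_mul_eq_div] at h_mid
  rw [← div_le_iff₀' hp]
  linarith

lemma IsTestFunction.integrable_midpointGap_gradient (h : IsTestFunction Ω φ)
    (h' : IsTestFunction Ω ψ) (hp : 0 < p) :
    Integrable fun x => midpointGap p (gradient φ x) (gradient ψ x) := by
  have h_mid := ((h.add h').const_mul (1 / 2)).integrable_norm_gradient_rpow volume hp
  simp only [(h.add h').gradient_const_mul, h.gradient_add h'] at h_mid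
  exact (((h.integrable_norm_gradient_rpow volume hp).add
    (h'.integrable_norm_gradient_rpow volume hp)).div_const 2).sub h_mid

lemma IsTestFunction.integral_norm_gradient_sub_rpow_le (h : IsTestFunction Ω φ)
    (h' : IsTestFunction Ω ψ) (hp : 0 < p) {ε K : ℝ}
    (hK : ∀ a b : E D, ‖a - b‖ ^ p ≤ ε * (‖a‖ ^ p + ‖b‖ ^ p) + K * midpointGap p a b) :
    ∫ x, ‖gradient φ x - gradient ψ x‖ ^ p ≤
      ε * ((∫ x, ‖gradient φ x‖ ^ p) + ∫ x, ‖gradient ψ x‖ ^ p) +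
        K * ∫ x, midpointGap p (gradient φ x) (gradient ψ x) := by
  have h_int := h.integrable_norm_gradient_rpow volume hp
  have h_int' := h'.integrable_norm_gradient_rpow volume hp
  have h_int_sub := (h.sub h').integrable_norm_gradient_rpow volume hp
  simp only [h.gradient_sub h'] at h_int_sub
  have h_int_gap := h.integrable_midpointGap_gradient h' hp
  have h_int_add : Integrable fun x => ‖gradient φ x‖ ^ p + ‖gradient ψ x‖ ^ p := h_int.add h_int'
  rw [← integral_add h_int h_int', ← integral_const_mul, ← integral_const_mul,
    ← integral_add (h_int_add.const_mul ε) (h_int_gap.const_mul K)]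
  exact integral_mono h_int_sub ((h_int_add.const_mul ε).add (h_int_gap.const_mul K))
    fun x => hK _ _

lemma exists_tendsto_sSup_energies (hbdd : BddAbove (energies p Ω)) :
    ∃ φ : ℕ → E D → ℝ, (∀ n, IsTestFunction Ω (φ n)) ∧
      Tendsto (fun n => energy p (φ n)) atTop (𝓝 (sSup (energies p Ω))) := by
  obtain ⟨u, -, hu, h_mem⟩ := exists_seq_tendsto_sSup (energies_nonempty p Ω) hbdd
  choose φ hφ h_energy using h_mem
  exact ⟨φ, hφ, by simpa only [h_energy] using hu⟩

lemma cauchy_gradient_of_tendsto_sSup_energies (hp : 1 < p) (hbdd : BddAbove (energies p Ω))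
    {φ : ℕ → E D → ℝ} (hφ : ∀ n, IsTestFunction Ω (φ n))
    (h_max : Tendsto (fun n => energy p (φ n)) atTop (𝓝 (sSup (energies p Ω)))) :
    ∀ ε > 0, ∃ N, ∀ m ≥ N, ∀ n ≥ N, ∫ x, ‖gradient (φ m) x - gradient (φ n) x‖ ^ p < ε := by
  intro ε hε
  have hp₀ : 0 < p := zero_lt_one.trans hp
  obtain ⟨B, hB, h_bound⟩ := exists_integral_norm_gradient_rpow_le hp hbdd
  obtain ⟨K, hK, h_gap⟩ := exists_norm_sub_rpow_le_midpointGap (V := E D) hp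
    (show 0 < ε / (4 * B) by positivity)
  set δ := min 1 (ε / (4 * (K * p + 1)))
  have hδ : 0 < δ := by positivity
  have hKδ : K * (p * δ) ≤ ε / 4 := by
    have h_le : δ * (4 * (K * p + 1)) ≤ ε := (le_div_iff₀ (by positivity)).1 (min_le_right _ _)
    linarith
  obtain ⟨N, hN⟩ := eventually_atTop.1 (h_max.eventually (le_mem_nhds (sub_lt_self _ hδ)))
  have h_grad (n : ℕ) (hn : n ≥ N) : ∫ x, ‖gradient (φ n) x‖ ^ p ≤ B :=
    h_bound _ (hφ n) (le_trans (by linarith [min_le_left 1 (ε / (4 * (K * p + 1)))]) (hN n hn))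
  refine ⟨N, fun m hm n hn => ?_⟩
  calc ∫ x, ‖gradient (φ m) x - gradient (φ n) x‖ ^ p
      ≤ ε / (4 * B) * (B + B) + K * (p * δ) := by
        refine ((hφ m).integral_norm_gradient_sub_rpow_le (hφ n) hp₀ h_gap).trans ?_
        gcongr
        · exact h_grad m hm
        · exact h_grad n hn
        · exact (hφ m).integral_midpointGap_gradient_le (hφ n) hp₀ hbdd (hN m hm) (hN n hn)
    _ = ε / 2 + K * (p * δ) := by
        field_simp
        ring
    _ < ε := by linarith

end MaximizingSequences

section TorsionFunction

variable {D : ℕ} {Ω : Set (E D)} {p q : ℝ} {φ : ℕ → E D → ℝ} {ψ u : E D → ℝ} {G : E D → E D}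

/-- The test functions `φ n` converge in `W^{1,p}(Ω)`, the limit having values `u` and gradient
`G`. -/
structure IsSobolevLimit (p : ℝ) (Ω : Set (E D)) (φ : ℕ → E D → ℝ) (u : E D → ℝ)
    (G : E D → E D) : Prop where
  isTestFunction : ∀ n, IsTestFunction Ω (φ n)
  memLp : MemLp u (ENNReal.ofReal p) (volume.restrict Ω)
  memLp_gradient : MemLp G (ENNReal.ofReal p) (volume.restrict Ω)
  tendsto : Tendsto (fun n => eLpNorm (fun x => u x - φ n x) (ENNReal.ofReal p)
    (volume.restrict Ω)) atTop (𝓝 0)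
  tendsto_gradient : Tendsto (fun n => eLpNorm (fun x => G x - gradient (φ n) x)
    (ENNReal.ofReal p) (volume.restrict Ω)) atTop (𝓝 0)

lemma IsTestFunction.setIntegral_smul_gradient (h : IsTestFunction Ω ψ) (η : E D → ℝ) :
    ∫ x in Ω, ψ x • gradient η x = ∫ x, ψ x • gradient η x :=
  setIntegral_eq_integral_of_forall_compl_eq_zero fun x hx => by rw [h.eq_zero hx, zero_smul]

namespace IsSobolevLimit

lemma isSobolevZero (h : IsSobolevLimit p Ω φ u G) (hpq : p.HolderConjugate q) :
    IsSobolevZero p Ω u G := by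
  refine ⟨⟨h.memLp, h.memLp_gradient, fun ψ hψ => ?_⟩, φ, h.isTestFunction, h.tendsto,
    h.tendsto_gradient⟩
  have h_lim := tendsto_integral_bilin hpq (ContinuousLinearMap.lsmul ℝ ℝ)
    (fun n => (h.isTestFunction n).memLp _ _) h.memLp (hψ.memLp_gradient _ _) h.tendsto
  have h_lim_grad := tendsto_integral_bilin hpq (ContinuousLinearMap.lsmul ℝ ℝ).flip
    (fun n => (h.isTestFunction n).memLp_gradient _ _) h.memLp_gradient (hψ.memLp _ _)
    h.tendsto_gradient
  simp only [ContinuousLinearMap.lsmul_apply, ContinuousLinearMap.flip_apply] at h_lim h_lim_grad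
  refine tendsto_nhds_unique h_lim (h_lim_grad.neg.congr fun n => ?_)
  rw [hψ.setIntegral_smul_gradient, (h.isTestFunction n).setIntegral_smul_gradient,
    (h.isTestFunction n).integral_smul_gradient hψ]

lemma add_smul (h : IsSobolevLimit p Ω φ u G) (hψ : IsTestFunction Ω ψ) (t : ℝ) :
    IsSobolevLimit p Ω (fun n x => φ n x + t * ψ x) (fun x => u x + t * ψ x)
      (fun x => G x + t • gradient ψ x) where
  isTestFunction n := (h.isTestFunction n).add (hψ.const_mul t)
  memLp := h.memLp.add ((hψ.const_mul t).memLp _ _)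
  memLp_gradient := h.memLp_gradient.add ((hψ.memLp_gradient _ _).const_smul t)
  tendsto := by simpa only [add_sub_add_right_eq_sub] using h.tendsto
  tendsto_gradient := by
    simpa only [(h.isTestFunction _).gradient_add (hψ.const_mul t), hψ.gradient_const_mul,
      add_sub_add_right_eq_sub] using h.tendsto_gradient

lemma tendsto_integral (h : IsSobolevLimit p Ω φ u G) (hp : 1 < p)
    (hb : Bornology.IsBounded Ω) : Tendsto (fun n => ∫ x, φ n x) atTop (𝓝 (∫ x in Ω, u x)) := by
  have : IsFiniteMeasure (volume.restrict Ω) := ⟨by simpa using hb.measure_lt_top⟩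
  simpa only [ContinuousLinearMap.mul_apply', mul_one, (h.isTestFunction _).setIntegral_eq] using
    tendsto_integral_bilin (Real.HolderConjugate.conjExponent hp) (ContinuousLinearMap.mul ℝ ℝ)
      (fun n => (h.isTestFunction n).memLp _ _) h.memLp (memLp_const (1 : ℝ)) h.tendsto

lemma tendsto_energy (h : IsSobolevLimit p Ω φ u G) (hp : 1 < p) (hb : Bornology.IsBounded Ω) :
    Tendsto (fun n => energy p (φ n)) atTop
      (𝓝 ((∫ x in Ω, u x) - 1 / p * ∫ x in Ω, ‖G x‖ ^ p)) := by
  have h_grad := tendsto_integral_norm_rpow hp.le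
    (fun n => (h.isTestFunction n).memLp_gradient _ _) h.memLp_gradient h.tendsto_gradient
  simp only [(h.isTestFunction _).setIntegral_norm_gradient_rpow_eq
    (zero_lt_one.trans hp).ne'] at h_grad
  exact (h.tendsto_integral hp hb).sub (h_grad.const_mul _)

lemma energy_le_sSup (h : IsSobolevLimit p Ω φ u G) (hp : 1 < p) (hb : Bornology.IsBounded Ω)
    (hbdd : BddAbove (energies p Ω)) :
    (∫ x in Ω, u x) - 1 / p * ∫ x in Ω, ‖G x‖ ^ p ≤ sSup (energies p Ω) :=
  le_of_tendsto' (h.tendsto_energy hp hb) fun n => (h.isTestFunction n).energy_le_sSup hbdd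

lemma euler_lagrange (h : IsSobolevLimit p Ω φ u G) (hp : 1 < p) (hb : Bornology.IsBounded Ω)
    (hbdd : BddAbove (energies p Ω))
    (h_max : (∫ x in Ω, u x) - 1 / p * ∫ x in Ω, ‖G x‖ ^ p = sSup (energies p Ω))
    (hψ : IsTestFunction Ω ψ) :
    ∫ x in Ω, inner ℝ (pFlux p (G x)) (gradient ψ x) = ∫ x in Ω, ψ x := by
  have : IsFiniteMeasure (volume.restrict Ω) := ⟨by simpa using hb.measure_lt_top⟩
  have hu : IntegrableOn u Ω := h.memLp.integrable (ENNReal.one_le_ofReal.2 hp.le)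
  have h_local_max : IsLocalMax (fun t : ℝ => (∫ x in Ω, u x) + t * (∫ x in Ω, ψ x) -
      1 / p * ∫ x in Ω, ‖G x + t • gradient ψ x‖ ^ p) 0 := Eventually.of_forall fun t => by
    have h_le := (h.add_smul hψ t).energy_le_sSup hp hb hbdd
    rw [integral_add hu ((hψ.integrable _).const_mul t), integral_const_mul] at h_le
    simpa only [zero_mul, add_zero, zero_smul, h_max] using h_le
  have h_deriv := (((hasDerivAt_id (0 : ℝ)).mul_const (∫ x in Ω, ψ x)).const_add
    (∫ x in Ω, u x)).sub ((hasDerivAt_integral_norm_rpow hp h.memLp_gradient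
      (hψ.memLp_gradient _ _)).const_mul (1 / p))
  have h_crit := h_local_max.hasDerivAt_eq_zero h_deriv
  rw [one_mul, ← mul_assoc, one_div_mul_cancel (zero_lt_one.trans hp).ne', one_mul] at h_crit
  exact (sub_eq_zero.1 h_crit).symm

lemma integral_norm_rpow_eq_of_weak (h : IsSobolevLimit p Ω φ u G) (hpq : p.HolderConjugate q)
    (hb : Bornology.IsBounded Ω)
    (h_weak : ∀ ψ, IsTestFunction Ω ψ →
      ∫ x in Ω, inner ℝ (pFlux p (G x)) (gradient ψ x) = ∫ x in Ω, ψ x) :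
    ∫ x in Ω, ‖G x‖ ^ p = ∫ x in Ω, u x := by
  have h_lim := tendsto_integral_bilin hpq (innerSL ℝ (E := E D)).flip
    (fun n => (h.isTestFunction n).memLp_gradient _ _) h.memLp_gradient
    (memLp_pFlux hpq h.memLp_gradient) h.tendsto_gradient
  simp only [ContinuousLinearMap.flip_apply, innerSL_apply_apply, inner_pFlux_self hpq.lt,
    h_weak _ (h.isTestFunction _), (h.isTestFunction _).setIntegral_eq] at h_lim
  exact tendsto_nhds_unique h_lim (h.tendsto_integral hpq.lt hb)

end IsSobolevLimit

lemma exists_isSobolevLimit [NeZero D] (hp : 1 ≤ p) (hb : Bornology.IsBounded Ω)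
    (hφ : ∀ n, IsTestFunction Ω (φ n))
    (h_cauchy : ∀ ε > 0, ∃ N, ∀ m ≥ N, ∀ n ≥ N,
      ∫ x, ‖gradient (φ m) x - gradient (φ n) x‖ ^ p < ε) :
    ∃ u G, IsSobolevLimit p Ω φ u G := by
  have hp₀ : 0 < p := zero_lt_one.trans_le hp
  obtain ⟨M, hM, hMΩ⟩ := hb.subset_ball_lt 0 0
  obtain ⟨u, hu, hu_lim⟩ := exists_memLp_tendsto_of_cauchy (μ := volume.restrict Ω) hp
    (fun n => (hφ n).memLp _ (ENNReal.ofReal p)) fun ε hε => by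
      obtain ⟨N, hN⟩ := h_cauchy (ε / (2 * M) ^ p) (by positivity)
      refine ⟨N, fun m hm n hn => ?_⟩
      have h_sub := (hφ m).sub (hφ n)
      have h_poincare := h_sub.poincare hp hM.le hMΩ
      simp only [(hφ m).gradient_sub (hφ n)] at h_poincare
      rw [h_sub.setIntegral_norm_rpow_eq hp₀.ne']
      exact h_poincare.trans_lt ((lt_div_iff₀' (by positivity)).1 (hN m hm n hn))
  obtain ⟨G, hG, hG_lim⟩ := exists_memLp_tendsto_of_cauchy (μ := volume.restrict Ω) hp
    (fun n => (hφ n).memLp_gradient _ (ENNReal.ofReal p)) fun ε hε => by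
      obtain ⟨N, hN⟩ := h_cauchy ε hε
      refine ⟨N, fun m hm n hn => ?_⟩
      have h_eq := ((hφ m).sub (hφ n)).setIntegral_norm_gradient_rpow_eq hp₀.ne'
      simp only [(hφ m).gradient_sub (hφ n)] at h_eq
      exact h_eq.trans_lt (hN m hm n hn)
  exact ⟨u, G, hφ, hu, hG, hu_lim, hG_lim⟩

theorem exists_isTorsionFunction [NeZero D] (hp : 1 < p) (hΩ : Ω ∈ convexDomains D) :
    ∃ u, IsTorsionFunction p Ω u := by
  have hbdd := bddAbove_energies hp hΩ
  obtain ⟨φ, hφ, h_max⟩ := exists_tendsto_sSup_energies hbdd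
  obtain ⟨u, G, h⟩ := exists_isSobolevLimit hp.le hΩ.2.1 hφ
    (cauchy_gradient_of_tendsto_sSup_energies hp hbdd hφ h_max)
  exact ⟨u, G, h.isSobolevZero (Real.HolderConjugate.conjExponent hp), fun ψ hψ =>
    h.euler_lagrange hp hΩ.2.1 hbdd
      (tendsto_nhds_unique (h.tendsto_energy hp hΩ.2.1) h_max) hψ⟩

theorem IsTorsionFunction.isLUB_energies (hpq : p.HolderConjugate q)
    (hb : Bornology.IsBounded Ω) (h : IsTorsionFunction p Ω u) :
    IsLUB (energies p Ω) ((∫ x in Ω, u x) / q) := by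
  obtain ⟨G, ⟨⟨hu, hG, -⟩, φ, hφ, hu_lim, hG_lim⟩, h_weak⟩ := h
  have h_lim : IsSobolevLimit p Ω φ u G := ⟨hφ, hu, hG, hu_lim, hG_lim⟩
  have h_norm := h_lim.integral_norm_rpow_eq_of_weak hpq hb h_weak
  refine ⟨Set.forall_mem_image.2 fun ψ (hψ : IsTestFunction Ω ψ) => ?_, fun b hb_upper => ?_⟩
  · have h_young := integral_inner_pFlux_le hpq hG
      (hψ.memLp_gradient (volume.restrict Ω) (ENNReal.ofReal p))
    rw [h_norm, hψ.setIntegral_norm_gradient_rpow_eq hpq.ne_zero] at h_young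
    have h_test := h_weak ψ hψ
    rw [hψ.setIntegral_eq] at h_test
    rw [energy, one_div_mul_eq_div, sub_le_iff_le_add, ← h_test]
    exact h_young
  · have h_value : (∫ x in Ω, u x) / q = (∫ x in Ω, u x) - 1 / p * ∫ x in Ω, ‖G x‖ ^ p := by
      rw [h_norm, div_eq_mul_inv, ← hpq.one_sub_inv]
      ring
    rw [h_value]
    exact le_of_tendsto' (h_lim.tendsto_energy hpq.lt hb) fun n => hb_upper ⟨_, hφ n, rfl⟩

theorem isTorsionFunction_torsionFunction [NeZero D] (hp : 1 < p) (hΩ : Ω ∈ convexDomains D) :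
    IsTorsionFunction p Ω (torsionFunction p Ω) := by
  have h := exists_isTorsionFunction hp hΩ
  rw [torsionFunction, dif_pos h]
  exact h.choose_spec

theorem isLUB_energies [NeZero D] (hpq : p.HolderConjugate q) (hΩ : Ω ∈ convexDomains D) :
    IsLUB (energies p Ω) (torsionalRigidity p Ω / q) :=
  (isTorsionFunction_torsionFunction hpq.lt hΩ).isLUB_energies hpq hΩ.2.1

end TorsionFunction

section Mollification

open scoped Convolution

variable {V : Type*} [NormedAddCommGroup V] [NormedSpace ℝ V] [HasContDiffBump V]
  [MeasurableSpace V] {μ : Measure V} {w : V → ℝ}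

/-- The mollification of `w` by the bump function `β`, normalized to have integral one. -/
noncomputable def mollify (β : ContDiffBump (0 : V)) (μ : Measure V) (w : V → ℝ) : V → ℝ :=
  β.normed μ ⋆[ContinuousLinearMap.lsmul ℝ ℝ, μ] w

lemma mollify_apply (β : ContDiffBump (0 : V)) (x : V) :
    mollify β μ w x = ∫ t, β.normed μ t * w (x - t) ∂μ := by
  simp only [mollify, convolution, ContinuousLinearMap.lsmul_apply, smul_eq_mul]

variable [FiniteDimensional ℝ V] [BorelSpace V] [μ.IsAddHaarMeasure] (β : ContDiffBump (0 : V))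

lemma contDiff_mollify (hw : LocallyIntegrable w μ) : ContDiff ℝ ∞ (mollify β μ w) :=
  β.hasCompactSupport_normed.contDiff_convolution_left _ β.contDiff_normed hw

lemma hasCompactSupport_mollify (hw : HasCompactSupport w) :
    HasCompactSupport (mollify β μ w) :=
  β.hasCompactSupport_normed.convolution _ hw

lemma tsupport_mollify_subset :
    tsupport (mollify β μ w) ⊆ Metric.cthickening β.rOut (Function.support w) := by
  refine closure_minimal (fun x hx => ?_) Metric.isClosed_cthickening
  obtain ⟨y, hy, t, ht, rfl⟩ := Set.mem_add.1 (support_convolution_subset_swap _ hx)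
  rw [β.support_normed_eq, mem_ball_zero_iff] at ht
  refine Metric.mem_cthickening_of_dist_le _ y _ _ hy ?_
  rw [dist_eq_norm, add_sub_cancel_left]
  exact ht.le

lemma integral_mollify (hw : Integrable w μ) : ∫ x, mollify β μ w x ∂μ = ∫ x, w x ∂μ := by
  rw [mollify, integral_convolution _ (β.continuous_normed.integrable_of_hasCompactSupport
    β.hasCompactSupport_normed) hw, β.integral_normed, ContinuousLinearMap.lsmul_apply, one_smul]

lemma abs_mollify_sub_le (hw : Continuous w) {x y : V} {L : ℝ}
    (h : ∀ t ∈ Metric.ball 0 β.rOut, |w (y - t) - w (x - t)| ≤ L) :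
    |mollify β μ w y - mollify β μ w x| ≤ L := by
  have h_int (z : V) : Integrable (fun t => β.normed μ t * w (z - t)) μ :=
    (β.continuous_normed.mul
      (hw.comp (continuous_const.sub continuous_id))).integrable_of_hasCompactSupport
        β.hasCompactSupport_normed.mul_right
  have h_le (t : V) :
      ‖β.normed μ t * w (y - t) - β.normed μ t * w (x - t)‖ ≤ β.normed μ t * L := by
    rw [← mul_sub, norm_mul, Real.norm_of_nonneg (β.nonneg_normed t), Real.norm_eq_abs]
    by_cases ht : t ∈ Metric.ball 0 β.rOut
    · exact mul_le_mul_of_nonneg_left (h t ht) (β.nonneg_normed t)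
    · rw [← β.support_normed_eq (μ := μ), Function.notMem_support] at ht
      simp only [ht, zero_mul, le_refl]
  calc |mollify β μ w y - mollify β μ w x|
      = |∫ t, (β.normed μ t * w (y - t) - β.normed μ t * w (x - t)) ∂μ| := by
        rw [mollify_apply, mollify_apply, integral_sub (h_int y) (h_int x)]
    _ ≤ ∫ t, β.normed μ t * L ∂μ := norm_integral_le_of_norm_le
        ((β.continuous_normed.integrable_of_hasCompactSupport
          β.hasCompactSupport_normed).mul_const L) (ae_of_all _ h_le)
    _ = L := by rw [integral_mul_const, β.integral_normed, one_mul]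

end Mollification

section SlopeBound

variable {V : Type*} [NormedAddCommGroup V] {w g : V → ℝ}

/-- `g` bounds the slopes of `w` at small scales, uniformly in the point: up to an error `ε`, the
number `g x` is a Lipschitz constant of `w` near `x`. For test functions this bounds the gradient,
and no differentiability of `w` is needed. -/
def IsSlopeBound (w g : V → ℝ) : Prop :=
  ∀ ε > 0, ∃ δ > 0, ∀ x, ∀ y ∈ Metric.ball x δ, ∀ z ∈ Metric.ball x δ,
    |w y - w z| ≤ (g x + ε) * ‖y - z‖

namespace IsSlopeBound

lemma continuous (h : IsSlopeBound w g) : Continuous w := by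
  obtain ⟨δ, hδ, h_lip⟩ := h 1 one_pos
  refine continuous_iff_continuousAt.2 fun x =>
    continuousAt_of_locally_lipschitz hδ (g x + 1) fun y hy => ?_
  rw [Real.dist_eq, dist_eq_norm]
  exact h_lip x y hy x (Metric.mem_ball_self hδ)

lemma const_sub (h : IsSlopeBound w g) (c : ℝ) : IsSlopeBound (fun x => c - w x) g := by
  intro ε hε
  obtain ⟨δ, hδ, h_lip⟩ := h ε hε
  refine ⟨δ, hδ, fun x y hy z hz => ?_⟩
  rw [sub_sub_sub_cancel_left, abs_sub_comm]
  exact h_lip x y hy z hz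

lemma max_zero (h : IsSlopeBound w g) : IsSlopeBound (fun x => max (w x) 0) g := by
  intro ε hε
  obtain ⟨δ, hδ, h_lip⟩ := h ε hε
  exact ⟨δ, hδ, fun x y hy z hz => (abs_max_sub_max_le_abs _ _ _).trans (h_lip x y hy z hz)⟩

lemma const_mul (h : IsSlopeBound w g) {c : ℝ} (hc : 0 < c) :
    IsSlopeBound (fun x => c * w x) (fun x => c * g x) := by
  intro ε hε
  obtain ⟨δ, hδ, h_lip⟩ := h (ε / c) (by positivity)
  refine ⟨δ, hδ, fun x y hy z hz => ?_⟩
  calc |c * w y - c * w z| = c * |w y - w z| := by rw [← mul_sub, abs_mul, abs_of_pos hc]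
    _ ≤ c * ((g x + ε / c) * ‖y - z‖) := mul_le_mul_of_nonneg_left (h_lip x y hy z hz) hc.le
    _ = (c * g x + ε) * ‖y - z‖ := by field_simp

end IsSlopeBound

end SlopeBound

section Competitors

variable {D : ℕ} {Ω : Set (E D)} {p b : ℝ} {w g : E D → ℝ}

lemma integrableOn_of_isBounded {f : E D → ℝ} (hf : Continuous f) (hb : Bornology.IsBounded Ω) :
    IntegrableOn f Ω :=
  (hf.continuousOn.integrableOn_compact hb.isCompact_closure).mono_set subset_closure

lemma exists_isTestFunction_of_lipschitz_on_balls (hΩ : IsOpen Ω) (hw : Continuous w)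
    {K : Set (E D)} (hK : IsCompact K) (hKΩ : K ⊆ Ω) (hwK : Function.support w ⊆ K) {δ : ℝ}
    (hδ : 0 < δ) (hg : ∀ x, 0 ≤ g x)
    (h_lip : ∀ x, ∀ y ∈ Metric.ball x δ, ∀ z ∈ Metric.ball x δ, |w y - w z| ≤ g x * ‖y - z‖) :
    ∃ φ, IsTestFunction Ω φ ∧ ∫ x, φ x = ∫ x, w x ∧ ∀ x, ‖gradient φ x‖ ≤ g x := by
  have hw_supp : HasCompactSupport w := hK.of_isClosed_subset (isClosed_tsupport w)
    (closure_minimal hwK hK.isClosed)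
  obtain ⟨r, hr, hrΩ⟩ := hK.exists_cthickening_subset_open hΩ hKΩ
  have hs : 0 < min r (δ / 2) := lt_min hr (half_pos hδ)
  let β : ContDiffBump (0 : E D) := ⟨min r (δ / 2) / 2, min r (δ / 2), half_pos hs, half_lt_self hs⟩
  refine ⟨mollify β volume w, ⟨contDiff_mollify β hw.locallyIntegrable,
    hasCompactSupport_mollify β hw_supp, (tsupport_mollify_subset β).trans ?_⟩,
    integral_mollify β (hw.integrable_of_hasCompactSupport hw_supp), fun x => ?_⟩
  · exact (Metric.cthickening_mono (min_le_left _ _) _).trans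
      ((Metric.cthickening_subset_of_subset _ hwK).trans hrΩ)
  rw [norm_gradient]
  refine norm_fderiv_le_of_lip' ℝ (hg x) ?_
  filter_upwards [Metric.ball_mem_nhds x (half_pos hδ)] with y hy
  refine abs_mollify_sub_le β hw fun t ht => ?_
  have ht_lt : ‖t‖ < δ / 2 := (mem_ball_zero_iff.1 ht).trans_le (min_le_right _ _)
  have h_near (z : E D) (hz : ‖z - x‖ < δ / 2) : z - t ∈ Metric.ball x δ := by
    rw [mem_ball_iff_norm, sub_right_comm]
    linarith [norm_sub_le (z - x) t]
  have h_le := h_lip x (y - t) (h_near y (mem_ball_iff_norm.1 hy)) (x - t)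
    (h_near x (by simpa using hδ))
  rwa [sub_sub_sub_cancel_right] at h_le

-- Truncating `w` at height `ε` moves its support away from the boundary.
lemma IsSlopeBound.setIntegral_sub_le (h : IsSlopeBound w g) (hp : 0 < p) (hΩ : IsOpen Ω)
    (hb : Bornology.IsBounded Ω) (hw : ∀ x ∉ Ω, w x = 0) (hg_cont : Continuous g)
    (hg : ∀ x, 0 ≤ g x) (hb_upper : b ∈ upperBounds (energies p Ω)) {ε : ℝ} (hε : 0 < ε) :
    (∫ x in Ω, w x) - ε * volume.real Ω - 1 / p * ∫ x in Ω, (g x + ε) ^ p ≤ b := by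
  obtain ⟨δ, hδ, h_lip⟩ := h ε hε
  have h_trunc : Continuous fun x => max (w x - ε) 0 :=
    (h.continuous.sub continuous_const).max continuous_const
  have h_superlevel : {x | ε ≤ w x} ⊆ Ω := fun x hx => by
    by_contra hxΩ
    exact (hε.trans_le hx).ne' (hw x hxΩ)
  obtain ⟨φ, hφ, hφ_int, hφ_grad⟩ := exists_isTestFunction_of_lipschitz_on_balls
    (w := fun x => max (w x - ε) 0) (g := fun x => g x + ε) hΩ h_trunc
    (Metric.isCompact_of_isClosed_isBounded (isClosed_le continuous_const h.continuous)
      (hb.subset h_superlevel)) h_superlevel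
    (fun x hx => by
      by_contra hxK
      exact hx (max_eq_right (sub_nonpos.2 (not_le.1 hxK).le)))
    hδ (fun x => add_nonneg (hg x) hε.le)
    (fun x y hy z hz => (abs_max_sub_max_le_abs _ _ _).trans
      (by simpa only [sub_sub_sub_cancel_right] using h_lip x y hy z hz))
  have h_values : (∫ x in Ω, w x) - ε * volume.real Ω ≤ ∫ x, φ x := by
    calc (∫ x in Ω, w x) - ε * volume.real Ω = ∫ x in Ω, (w x - ε) := by
          rw [integral_sub (integrableOn_of_isBounded h.continuous hb)
            (integrableOn_const hb.measure_lt_top.ne), setIntegral_const, smul_eq_mul, mul_comm]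
      _ ≤ ∫ x in Ω, max (w x - ε) 0 := integral_mono
          (integrableOn_of_isBounded (h.continuous.sub continuous_const) hb)
          (integrableOn_of_isBounded h_trunc hb) fun x => le_max_left _ _
      _ = ∫ x, φ x := by
          rw [hφ_int]
          exact setIntegral_eq_integral_of_forall_compl_eq_zero fun x hx => by
            rw [hw x hx, zero_sub, max_eq_right (neg_nonpos.2 hε.le)]
  have h_gradients : ∫ x, ‖gradient φ x‖ ^ p ≤ ∫ x in Ω, (g x + ε) ^ p := by
    rw [← hφ.setIntegral_norm_gradient_rpow_eq hp.ne']
    exact integral_mono (hφ.integrable_norm_gradient_rpow _ hp)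
      (integrableOn_of_isBounded ((hg_cont.add continuous_const).rpow_const
        fun _ => Or.inr hp.le) hb)
      fun x => Real.rpow_le_rpow (norm_nonneg _) (hφ_grad x) hp.le
  calc (∫ x in Ω, w x) - ε * volume.real Ω - 1 / p * ∫ x in Ω, (g x + ε) ^ p
      ≤ (∫ x, φ x) - 1 / p * ∫ x, ‖gradient φ x‖ ^ p := by gcongr
    _ ≤ b := hb_upper ⟨φ, hφ, rfl⟩

lemma continuous_setIntegral_add_rpow (hp : 0 ≤ p) (hb : Bornology.IsBounded Ω)
    (hg : Continuous g) : Continuous fun ε : ℝ => ∫ x in Ω, (g x + ε) ^ p := by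
  have h_joint : Continuous (Function.uncurry fun (ε : ℝ) x => (g x + ε) ^ p) :=
    ((hg.comp continuous_snd).add continuous_fst).rpow_const fun _ => Or.inr hp
  have h_closure := continuous_parametric_integral_of_continuous (μ := volume.restrict Ω) h_joint
    hb.isCompact_closure
  rwa [Measure.restrict_restrict isClosed_closure.measurableSet,
    Set.inter_eq_right.2 subset_closure] at h_closure

theorem IsSlopeBound.energy_le (h : IsSlopeBound w g) (hp : 0 < p) (hΩ : IsOpen Ω)
    (hb : Bornology.IsBounded Ω) (hw : ∀ x ∉ Ω, w x = 0) (hg_cont : Continuous g)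
    (hg : ∀ x, 0 ≤ g x) (hb_upper : b ∈ upperBounds (energies p Ω)) :
    (∫ x in Ω, w x) - 1 / p * ∫ x in Ω, g x ^ p ≤ b := by
  have h_cont : Continuous fun ε : ℝ =>
      (∫ x in Ω, w x) - ε * volume.real Ω - 1 / p * ∫ x in Ω, (g x + ε) ^ p :=
    (continuous_const.sub (continuous_id.mul continuous_const)).sub
      (continuous_const.mul (continuous_setIntegral_add_rpow hp.le hb hg_cont))
  have h_lim := (h_cont.tendsto 0).mono_left (nhdsWithin_le_nhds (s := Set.Ioi 0))
  simp only [zero_mul, sub_zero, add_zero] at h_lim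
  exact le_of_tendsto h_lim (eventually_mem_nhdsWithin.mono fun ε hε =>
    h.setIntegral_sub_le hp hΩ hb hw hg_cont hg hb_upper hε)

end Competitors

section Scaling

open scoped Pointwise

variable {D : ℕ} {Ω : Set (E D)} {p q t : ℝ} {φ : E D → ℝ}

lemma smul_mem_convexDomains (hΩ : Ω ∈ convexDomains D) (ht : t ≠ 0) :
    t • Ω ∈ convexDomains D :=
  ⟨hΩ.1.smul₀ ht, hΩ.2.1.smul₀ t, hΩ.2.2.1.smul t, hΩ.2.2.2.smul_set⟩

lemma smul_ball_subset_smul {x : E D} {r : ℝ} (ht : 0 < t) (h : Metric.ball x r ⊆ Ω) :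
    Metric.ball (t • x) (t * r) ⊆ t • Ω := by
  have h_smul := Set.smul_set_mono (a := t) h
  rwa [smul_ball ht.ne', Real.norm_of_nonneg ht.le] at h_smul

lemma inradius_smul (Ω : Set (E D)) (ht : 0 < t) : inradius (t • Ω) = t * inradius Ω := by
  have h_radii : {r : ℝ | 0 < r ∧ ∃ x, Metric.ball x r ⊆ t • Ω} =
      t • {r : ℝ | 0 < r ∧ ∃ x, Metric.ball x r ⊆ Ω} := by
    ext r
    rw [Set.mem_smul_set_iff_inv_smul_mem₀ ht.ne']
    refine and_congr (by simp [ht]) ⟨fun ⟨x, hx⟩ => ⟨t⁻¹ • x, ?_⟩, fun ⟨x, hx⟩ => ⟨t • x, ?_⟩⟩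
    · simpa only [inv_smul_smul₀ ht.ne', smul_eq_mul] using
        smul_ball_subset_smul (inv_pos.2 ht) hx
    · simpa only [smul_eq_mul, mul_inv_cancel_left₀ ht.ne'] using smul_ball_subset_smul ht hx
  rw [inradius, h_radii, Real.sSup_smul_of_nonneg ht.le, smul_eq_mul, inradius]

lemma volume_real_smul (Ω : Set (E D)) (ht : 0 ≤ t) :
    volume.real (t • Ω) = t ^ D * volume.real Ω := by
  rw [Measure.real, Measure.addHaar_smul_of_nonneg _ ht, finrank_euclideanSpace_fin,
    ENNReal.toReal_mul, ENNReal.toReal_ofReal (pow_nonneg ht D), Measure.real]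

lemma IsTestFunction.comp_inv_smul (h : IsTestFunction Ω φ) (ht : t ≠ 0) :
    IsTestFunction (t • Ω) fun x => φ (t⁻¹ • x) := by
  have h_emb : Topology.IsClosedEmbedding fun x : E D => t⁻¹ • x :=
    (Homeomorph.smulOfNeZero t⁻¹ (inv_ne_zero ht)).isClosedEmbedding
  refine ⟨h.1.comp (contDiff_const_smul _), h.2.1.comp_isClosedEmbedding h_emb, fun x hx => ?_⟩
  rw [Set.mem_smul_set_iff_inv_smul_mem₀ ht]
  exact h.2.2 (tsupport_comp_subset_preimage φ h_emb.continuous hx)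

lemma IsTestFunction.energy_scaling (h : IsTestFunction Ω φ) (hpq : p.HolderConjugate q)
    (ht : 0 < t) :
    energy p (fun x => t ^ q * φ (t⁻¹ • x)) = t ^ q * t ^ D * energy p φ := by
  have h_exp : (t ^ q) ^ p * t⁻¹ ^ p = t ^ q := by
    rw [← Real.mul_rpow (by positivity) (by positivity), ← div_eq_mul_inv,
      ← Real.rpow_sub_one ht.ne', ← Real.rpow_mul ht.le, hpq.symm.sub_one_mul_conj]
  rw [(h.comp_inv_smul ht.ne').energy_const_mul (by positivity)]
  simp only [gradient_comp_smul, norm_smul_rpow (inv_nonneg.2 ht.le), integral_const_mul]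
  rw [Measure.integral_comp_inv_smul_of_nonneg volume φ ht.le,
    Measure.integral_comp_inv_smul_of_nonneg volume (fun x => ‖gradient φ x‖ ^ p) ht.le,
    finrank_euclideanSpace_fin, smul_eq_mul, smul_eq_mul, energy]
  linear_combination (-(1 / p) * t ^ D * ∫ x, ‖gradient φ x‖ ^ p) * h_exp

lemma torsionalRigidity_smul_ge [NeZero D] (hpq : p.HolderConjugate q) (hΩ : Ω ∈ convexDomains D)
    (ht : 0 < t) :
    t ^ q * t ^ D * torsionalRigidity p Ω ≤ torsionalRigidity p (t • Ω) := by
  have h_le : torsionalRigidity p Ω / q ≤ torsionalRigidity p (t • Ω) / q / (t ^ q * t ^ D) := by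
    refine (isLUB_energies hpq hΩ).2 (Set.forall_mem_image.2 fun φ (hφ : IsTestFunction Ω φ) => ?_)
    rw [le_div_iff₀' (by positivity), ← hφ.energy_scaling hpq ht]
    exact (isLUB_energies hpq (smul_mem_convexDomains hΩ ht.ne')).1
      ⟨_, (hφ.comp_inv_smul ht.ne').const_mul _, rfl⟩
  rwa [div_right_comm, div_le_div_iff_of_pos_right hpq.symm.pos, le_div_iff₀' (by positivity)]
    at h_le

lemma torsionalRigidity_smul [NeZero D] (hpq : p.HolderConjugate q) (hΩ : Ω ∈ convexDomains D)
    (ht : 0 < t) :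
    torsionalRigidity p (t • Ω) = t ^ q * t ^ D * torsionalRigidity p Ω := by
  refine le_antisymm ?_ (torsionalRigidity_smul_ge hpq hΩ ht)
  have h := torsionalRigidity_smul_ge hpq (smul_mem_convexDomains hΩ ht.ne') (inv_pos.2 ht)
  rwa [inv_smul_smul₀ ht.ne', Real.inv_rpow ht.le, inv_pow, ← mul_inv,
    inv_mul_le_iff₀ (by positivity)] at h

end Scaling

section Homogeneous

open Module
open scoped Pointwise

variable {V : Type*} [NormedAddCommGroup V] [NormedSpace ℝ V] {j : V → ℝ} {q t : ℝ}

lemma setOf_lt_of_homogeneous (h_smul : ∀ s > 0, ∀ x, j (s • x) = s * j x) (ht : 0 < t) :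
    {x | j x < t} = t • {x | j x < 1} := by
  ext x
  rw [Set.mem_smul_set_iff_inv_smul_mem₀ ht.ne']
  simp only [Set.mem_ofPred_eq, h_smul _ (inv_pos.2 ht), inv_mul_lt_iff₀ ht, mul_one]

variable [FiniteDimensional ℝ V] [MeasurableSpace V] [BorelSpace V] {μ : Measure V}
  [μ.IsAddHaarMeasure]

lemma measureReal_restrict_le_rpow_of_homogeneous (hj : Measurable j) (hj_nonneg : ∀ x, 0 ≤ j x)
    (h_smul : ∀ s > 0, ∀ x, j (s • x) = s * j x) (h_fin : μ {x | j x < 1} ≠ ⊤) (hq : 0 < q)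
    (ht : t ∈ Set.Ioc (0 : ℝ) 1) :
    (μ.restrict {x | j x < 1}).real {x | t ≤ j x ^ q} =
      μ.real {x | j x < 1} - t ^ (finrank ℝ V / q) * μ.real {x | j x < 1} := by
  have h_root : 0 < t ^ q⁻¹ := Real.rpow_pos_of_pos ht.1 _
  have h_sublevel : {x | j x < t ^ q⁻¹} ⊆ {x | j x < 1} := fun x (hx : j x < _) =>
    hx.trans_le (Real.rpow_le_one ht.1.le ht.2 (inv_nonneg.2 hq.le))
  have h_superlevel :
      {x | t ≤ j x ^ q} ∩ {x | j x < 1} = {x | j x < 1} \ {x | j x < t ^ q⁻¹} := by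
    ext x
    simp only [Set.mem_inter_iff, Set.mem_sdiff, Set.mem_ofPred_eq, not_lt,
      Real.rpow_inv_le_iff_of_pos ht.1.le (hj_nonneg x) hq, and_comm]
  rw [measureReal_restrict_apply (measurableSet_le measurable_const (hj.pow_const q)),
    h_superlevel, measureReal_sdiff h_sublevel (measurableSet_lt hj measurable_const) h_fin,
    setOf_lt_of_homogeneous h_smul h_root, measureReal_def, measureReal_def,
    Measure.addHaar_smul_of_nonneg _ h_root.le, ENNReal.toReal_mul,
    ENNReal.toReal_ofReal (by positivity), ← Real.rpow_natCast, ← Real.rpow_mul ht.1.le,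
    inv_mul_eq_div]

theorem setIntegral_rpow_of_homogeneous (hj : Measurable j) (hj_nonneg : ∀ x, 0 ≤ j x)
    (h_smul : ∀ s > 0, ∀ x, j (s • x) = s * j x) (h_fin : μ {x | j x < 1} ≠ ⊤) (hq : 0 < q) :
    ∫ x in {x | j x < 1}, j x ^ q ∂μ =
      finrank ℝ V / (finrank ℝ V + q) * μ.real {x | j x < 1} := by
  have h_meas : MeasurableSet {x | j x < 1} := measurableSet_lt hj measurable_const
  have h_le_one : ∀ᵐ x ∂μ.restrict {x | j x < 1}, j x ^ q ≤ 1 :=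
    ae_restrict_of_forall_mem h_meas fun x hx => Real.rpow_le_one (hj_nonneg x) hx.le hq.le
  have h_int : IntegrableOn (fun x => j x ^ q) {x | j x < 1} μ := by
    refine Measure.integrableOn_of_bounded h_fin (hj.pow_const q).aestronglyMeasurable (M := 1) ?_
    filter_upwards [h_le_one] with x hx
    rwa [Real.norm_of_nonneg (Real.rpow_nonneg (hj_nonneg x) q)]
  have h_exp : 0 ≤ (finrank ℝ V : ℝ) / q := by positivity
  rw [h_int.integral_eq_integral_Ioc_meas_le
      (ae_of_all _ fun x => Real.rpow_nonneg (hj_nonneg x) q) h_le_one,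
    setIntegral_congr_fun measurableSet_Ioc fun t ht =>
      measureReal_restrict_le_rpow_of_homogeneous hj hj_nonneg h_smul h_fin hq ht,
    ← intervalIntegral.integral_of_le zero_le_one,
    intervalIntegral.integral_sub (by simp)
      ((intervalIntegral.intervalIntegrable_rpow (Or.inl h_exp)).mul_const _),
    intervalIntegral.integral_const, intervalIntegral.integral_mul_const,
    integral_rpow (Or.inl (by linarith)), Real.one_rpow, Real.zero_rpow (by positivity)]
  have h_sum : (finrank ℝ V : ℝ) + q ≠ 0 := by positivity
  simp only [sub_zero, one_smul]
  field_simp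
  ring

end Homogeneous

section SlopeBoundComp

variable {V : Type*} [NormedAddCommGroup V] {s : V → ℝ}

lemma isSlopeBound_comp_of_lipschitz {f f' : ℝ → ℝ} {S : Set ℝ} {K : NNReal} (hK : 0 < K)
    (hS : IsCompact S) (hS_conv : Convex ℝ S) (hf : ∀ u ∈ S, HasDerivWithinAt f (f' u) S u)
    (hf' : ContinuousOn f' S) (hs : LipschitzWith K s) (hs_mem : ∀ x, s x ∈ S) :
    IsSlopeBound (fun x => f (s x)) fun x => |f' (s x)| * K := by
  intro ε hε
  obtain ⟨δ, hδ, h_unif⟩ := Metric.uniformContinuousOn_iff.1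
    (hS.uniformContinuousOn_of_continuous hf') (ε / K) (by positivity)
  refine ⟨δ / K, by positivity, fun x y hy z hz => ?_⟩
  have h_near {y : V} (hy : y ∈ Metric.ball x (δ / K)) : s y ∈ S ∩ Metric.ball (s x) δ := by
    refine ⟨hs_mem y, (hs.dist_le_mul y x).trans_lt ?_⟩
    rwa [Metric.mem_ball, lt_div_iff₀' (by positivity)] at hy
  have h_deriv : ∀ u ∈ S ∩ Metric.ball (s x) δ, ‖f' u‖ ≤ |f' (s x)| + ε / K := fun u hu => by
    have h_close := h_unif u hu.1 (s x) (hs_mem x) hu.2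
    rw [dist_eq_norm] at h_close
    linarith [norm_le_norm_add_norm_sub' (f' u) (f' (s x)), Real.norm_eq_abs (f' (s x))]
  have h_mean := Convex.norm_image_sub_le_of_norm_hasDerivWithin_le
    (fun u hu => (hf u hu.1).mono Set.inter_subset_left) h_deriv
    (hS_conv.inter (convex_ball (s x) δ)) (h_near hz) (h_near hy)
  calc |f (s y) - f (s z)| ≤ (|f' (s x)| + ε / K) * ‖s y - s z‖ := h_mean
    _ ≤ (|f' (s x)| + ε / K) * (K * ‖y - z‖) := by gcongr; exact hs.norm_sub_le y z
    _ = (|f' (s x)| * K + ε) * ‖y - z‖ := by field_simp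

end SlopeBoundComp

section Translation

variable {D : ℕ} {Ω : Set (E D)} {φ : E D → ℝ} {p : ℝ}

lemma energy_comp_sub (p : ℝ) (φ : E D → ℝ) (a : E D) :
    energy p (fun x => φ (x - a)) = energy p φ := by
  simp only [energy, norm_gradient, fderiv_comp_sub]
  rw [integral_sub_right_eq_self, integral_sub_right_eq_self fun x => ‖fderiv ℝ φ x‖ ^ p]

lemma IsTestFunction.comp_sub {a : E D} (h : IsTestFunction ((a + ·) ⁻¹' Ω) φ) :
    IsTestFunction Ω fun x => φ (x - a) := by
  have h_emb : Topology.IsClosedEmbedding fun x : E D => x - a :=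
    (Homeomorph.subRight a).isClosedEmbedding
  refine ⟨h.1.comp (contDiff_id.sub contDiff_const), h.2.1.comp_isClosedEmbedding h_emb,
    fun x hx => ?_⟩
  have h_mem := h.2.2 (tsupport_comp_subset_preimage φ h_emb.continuous hx)
  rwa [Set.mem_preimage, add_sub_cancel] at h_mem

lemma energies_preimage_add_subset (p : ℝ) (Ω : Set (E D)) (a : E D) :
    energies p ((a + ·) ⁻¹' Ω) ⊆ energies p Ω := by
  rintro _ ⟨φ, hφ, rfl⟩
  exact ⟨_, IsTestFunction.comp_sub hφ, energy_comp_sub p φ a⟩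

lemma preimage_add_mem_convexDomains (hΩ : Ω ∈ convexDomains D) (a : E D) :
    (a + ·) ⁻¹' Ω ∈ convexDomains D :=
  ⟨hΩ.1.preimage (continuous_const_add a),
    (isometry_add_left a).antilipschitz.isBounded_preimage hΩ.2.1,
    hΩ.2.2.1.translate_preimage_right a, hΩ.2.2.2.preimage (add_left_surjective a)⟩

end Translation

section WebFunction

variable {D : ℕ} {Ω : Set (E D)} {p q r b : ℝ}

/-- The gauge of `Ω` truncated at `1`: the extension by `1` of the gauge of an open convex set
containing the origin. The competitors in the lower bound for the torsional rigidity are functions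
of it. -/
noncomputable def truncGauge (Ω : Set (E D)) (x : E D) : ℝ :=
  min (gauge Ω x) 1

lemma truncGauge_mem_Icc (Ω : Set (E D)) (x : E D) : truncGauge Ω x ∈ Set.Icc (0 : ℝ) 1 :=
  ⟨le_min (gauge_nonneg x) zero_le_one, min_le_right _ _⟩

lemma lipschitzWith_truncGauge (hΩ : Convex ℝ Ω) {r : NNReal} (hr : 0 < r)
    (h_ball : Metric.ball 0 r ⊆ Ω) : LipschitzWith r⁻¹ (truncGauge Ω) :=
  (hΩ.lipschitzWith_gauge hr h_ball).min_const 1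

lemma truncGauge_of_mem (hΩ : IsOpen Ω) {x : E D} (hx : x ∈ Ω) : truncGauge Ω x = gauge Ω x :=
  min_eq_left (gauge_lt_one_of_mem_of_isOpen hΩ hx).le

lemma truncGauge_of_notMem (hΩ : Convex ℝ Ω) (h_zero : Ω ∈ 𝓝 0) {x : E D} (hx : x ∉ Ω) :
    truncGauge Ω x = 1 :=
  min_eq_right (one_le_gauge_of_notMem (hΩ.starConvex (mem_of_mem_nhds h_zero))
    (absorbent_nhds_zero h_zero x) hx)

lemma setIntegral_truncGauge_rpow (hΩ : Ω ∈ convexDomains D) (h_zero : (0 : E D) ∈ Ω)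
    (hq : 0 < q) : ∫ x in Ω, truncGauge Ω x ^ q = D / (D + q) * volume.real Ω := by
  have h_unit : {x | gauge Ω x < 1} = Ω :=
    setOfPred_gauge_lt_one_eq_self_of_isOpen hΩ.2.2.1 h_zero hΩ.1
  have h_gauge := setIntegral_rpow_of_homogeneous (μ := volume)
    (continuous_gauge hΩ.2.2.1 (hΩ.1.mem_nhds h_zero)).measurable gauge_nonneg
    (fun s hs x => gauge_smul_of_nonneg hs.le x)
    (by rw [h_unit]; exact hΩ.2.1.measure_lt_top.ne) hq
  rw [h_unit, finrank_euclideanSpace_fin] at h_gauge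
  rw [← h_gauge]
  exact setIntegral_congr_fun hΩ.1.measurableSet fun x hx => by
    simp only [truncGauge_of_mem hΩ.1 hx]

lemma isSlopeBound_truncGauge_rpow (hΩ : Convex ℝ Ω) (hr : 0 < r)
    (h_ball : Metric.ball 0 r ⊆ Ω) (hq : 1 ≤ q) :
    IsSlopeBound (fun x => truncGauge Ω x ^ q) fun x => q * truncGauge Ω x ^ (q - 1) / r := by
  have h_slope := isSlopeBound_comp_of_lipschitz (K := ⟨r, hr.le⟩⁻¹) (S := Set.Icc 0 1)
    (inv_pos.2 hr) isCompact_Icc (convex_Icc 0 1)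
    (fun u _ => (Real.hasDerivAt_rpow_const (Or.inr hq)).hasDerivWithinAt)
    (continuous_const.mul (Real.continuous_rpow_const (sub_nonneg.2 hq))).continuousOn
    (lipschitzWith_truncGauge hΩ hr h_ball) (truncGauge_mem_Icc Ω)
  convert h_slope using 2 with x
  rw [abs_of_nonneg (mul_nonneg (by linarith) (Real.rpow_nonneg (truncGauge_mem_Icc Ω x).1 _)),
    div_eq_mul_inv]
  rfl

-- The competitor is `(D/q) (r/D)^q (1 - s^q)`, where `s` is the truncated gauge and the factor is
-- the optimal one among its multiples.
lemma le_of_ball_zero_subset [NeZero D] (hpq : p.HolderConjugate q) (hΩ : Ω ∈ convexDomains D)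
    (hr : 0 < r) (h_ball : Metric.ball 0 r ⊆ Ω) (hb_upper : b ∈ upperBounds (energies p Ω)) :
    volume.real Ω * (D * (r / D) ^ q / (D + q)) / q ≤ b := by
  have hD : (0 : ℝ) < D := Nat.cast_pos.2 (NeZero.pos D)
  have hq := hpq.symm.pos
  have h_zero : (0 : E D) ∈ Ω := h_ball (Metric.mem_ball_self hr)
  have h_cont : Continuous (truncGauge Ω) :=
    (lipschitzWith_truncGauge (r := ⟨r, hr.le⟩) hΩ.2.2.1 hr h_ball).continuous
  have h_nonneg (x : E D) : 0 ≤ truncGauge Ω x := (truncGauge_mem_Icc Ω x).1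
  have h_slope : IsSlopeBound (fun x => D * (r / D) ^ q / q * (1 - truncGauge Ω x ^ q))
      fun x => (r / D * truncGauge Ω x) ^ (q - 1) := by
    convert ((isSlopeBound_truncGauge_rpow hΩ.2.2.1 hr h_ball hpq.symm.lt.le).const_sub
      1).const_mul (show 0 < D * (r / D) ^ q / q by positivity) using 2 with x
    rw [Real.mul_rpow (by positivity) (h_nonneg x), Real.rpow_sub_one (by positivity)]
    field_simp
  have h_energy := h_slope.energy_le hpq.pos hΩ.1 hΩ.2.1
    (fun x hx => by
      rw [truncGauge_of_notMem hΩ.2.2.1 (hΩ.1.mem_nhds h_zero) hx, Real.one_rpow, sub_self,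
        mul_zero])
    ((continuous_const.mul h_cont).rpow_const fun _ => Or.inr hpq.symm.sub_one_pos.le)
    (fun x => Real.rpow_nonneg (mul_nonneg (by positivity) (h_nonneg x)) _) hb_upper
  have h_values : ∫ x in Ω, D * (r / D) ^ q / q * (1 - truncGauge Ω x ^ q) =
      D * (r / D) ^ q / q * (volume.real Ω - D / (D + q) * volume.real Ω) := by
    rw [integral_const_mul, integral_sub
      (integrableOn_const (C := (1 : ℝ)) hΩ.2.1.measure_lt_top.ne) (integrableOn_of_isBounded
        (h_cont.rpow_const fun _ => Or.inr hq.le) hΩ.2.1),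
      setIntegral_truncGauge_rpow hΩ h_zero hq, setIntegral_const, smul_eq_mul, mul_one]
  have h_gradients : ∫ x in Ω, ((r / D * truncGauge Ω x) ^ (q - 1)) ^ p =
      (r / D) ^ q * (D / (D + q) * volume.real Ω) := by
    rw [← setIntegral_truncGauge_rpow hΩ h_zero hq, ← integral_const_mul]
    congr with x
    rw [← Real.rpow_mul (mul_nonneg (by positivity) (h_nonneg x)), hpq.symm.sub_one_mul_conj,
      Real.mul_rpow (by positivity) (h_nonneg x)]
  rw [h_values, h_gradients, one_div, ← hpq.symm.one_sub_inv] at h_energy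
  refine le_trans (le_of_eq ?_) h_energy
  field_simp
  ring

theorem le_of_ball_subset [NeZero D] (hpq : p.HolderConjugate q) (hΩ : Ω ∈ convexDomains D)
    {a : E D} (hr : 0 < r) (h_ball : Metric.ball a r ⊆ Ω)
    (hb_upper : b ∈ upperBounds (energies p Ω)) :
    volume.real Ω * (D * (r / D) ^ q / (D + q)) / q ≤ b := by
  have h_ball_zero : Metric.ball 0 r ⊆ (a + ·) ⁻¹' Ω := fun x hx =>
    h_ball (by simpa only [mem_ball_iff_norm, add_sub_cancel_left, sub_zero] using hx)
  have h_le := le_of_ball_zero_subset hpq (preimage_add_mem_convexDomains hΩ a) hr h_ball_zero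
    (upperBounds_mono_set (energies_preimage_add_subset p Ω a) hb_upper)
  rwa [measureReal_def, measure_preimage_add, ← measureReal_def] at h_le

end WebFunction

section Ball

variable {D : ℕ} {Ω : Set (E D)} {φ : E D → ℝ}

lemma ball_mem_convexDomains (D : ℕ) : Metric.ball (0 : E D) 1 ∈ convexDomains D :=
  ⟨Metric.isOpen_ball, Metric.isBounded_ball, convex_ball 0 1,
    ⟨0, Metric.mem_ball_self one_pos⟩⟩

lemma IsTestFunction.integrable_coord_mul_fderiv (h : IsTestFunction Ω φ) (i : Fin D) (v : E D) :
    Integrable fun x => x i * fderiv ℝ φ x v :=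
  ((EuclideanSpace.proj i : E D →L[ℝ] ℝ).continuous.mul
    ((h.1.continuous_fderiv (by simp)).clm_apply continuous_const)).integrable_of_hasCompactSupport
      ((h.2.1.fderiv ℝ).comp_left (g := fun f : E D →L[ℝ] ℝ => f v) rfl).mul_left

lemma IsTestFunction.integral_coord_mul_fderiv (h : IsTestFunction Ω φ) (i : Fin D) (v : E D) :
    ∫ x, x i * fderiv ℝ φ x v = -(v i * ∫ x, φ x) := by
  have h_coord (x : E D) : fderiv ℝ (fun y : E D => y i) x v = v i := by
    have h_deriv : HasFDerivAt (fun y : E D => y i) (EuclideanSpace.proj i : E D →L[ℝ] ℝ) x :=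
      (EuclideanSpace.proj i : E D →L[ℝ] ℝ).hasFDerivAt
    rw [h_deriv.fderiv, PiLp.proj_apply]
  rw [integral_mul_fderiv_eq_neg_fderiv_mul_of_integrable
    (by simpa only [h_coord] using (h.integrable volume).const_mul (v i))
    (h.integrable_coord_mul_fderiv i v)
    (((EuclideanSpace.proj i : E D →L[ℝ] ℝ).continuous.mul
      h.continuous).integrable_of_hasCompactSupport h.2.1.mul_left)
    (fun x _ => (EuclideanSpace.proj i : E D →L[ℝ] ℝ).differentiableAt)
    fun x _ => h.differentiable x]
  simp only [h_coord, integral_const_mul]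

lemma IsTestFunction.integral_inner_gradient_self (h : IsTestFunction Ω φ) :
    ∫ x, inner ℝ (gradient φ x) x = -(D * ∫ x, φ x) := by
  have h_sum (x : E D) : inner ℝ (gradient φ x) x =
      ∑ i, x i * fderiv ℝ φ x (EuclideanSpace.basisFun (Fin D) ℝ i) := by
    rw [inner_gradient_left]
    conv_lhs => enter [2]; rw [← (EuclideanSpace.basisFun (Fin D) ℝ).sum_repr x]
    simp only [map_sum, map_smul, EuclideanSpace.basisFun_repr, smul_eq_mul]
  simp only [h_sum]
  rw [integral_finsetSum _ fun i _ => h.integrable_coord_mul_fderiv i _]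
  simp [h.integral_coord_mul_fderiv]

lemma setIntegral_norm_rpow_ball (D : ℕ) {q : ℝ} (hq : 0 < q) :
    ∫ x in Metric.ball (0 : E D) 1, ‖x‖ ^ q =
      D / (D + q) * volume.real (Metric.ball (0 : E D) 1) := by
  have h_ball : {x : E D | ‖x‖ < 1} = Metric.ball 0 1 := by
    ext x
    exact mem_ball_zero_iff.symm
  have h_norm := setIntegral_rpow_of_homogeneous (μ := volume) (j := fun x : E D => ‖x‖)
    measurable_norm norm_nonneg
    (fun s hs x => by rw [norm_smul, Real.norm_of_nonneg (le_of_lt hs)])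
    (by rw [h_ball]; exact Metric.isBounded_ball.measure_lt_top.ne) hq
  rwa [h_ball, finrank_euclideanSpace_fin] at h_norm

lemma neg_mul_inner_le {V : Type*} [NormedAddCommGroup V] [InnerProductSpace ℝ V] (c : ℝ)
    (v x : V) :
    -(c * inner ℝ v x) ≤ 1 / 2 * ‖v‖ ^ 2 + c ^ 2 / 2 * ‖x‖ ^ 2 := by
  have h_sq := norm_add_sq_real v (c • x)
  rw [real_inner_smul_right, norm_smul, mul_pow, Real.norm_eq_abs, sq_abs] at h_sq
  linarith [sq_nonneg ‖v + c • x‖]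

lemma energy_two_le_of_ball [NeZero D] (h : IsTestFunction (Metric.ball (0 : E D) 1) φ) :
    energy 2 φ ≤ volume.real (Metric.ball (0 : E D) 1) / (D * (D + 2)) / 2 := by
  have hD : (0 : ℝ) < D := Nat.cast_pos.2 (NeZero.pos D)
  have h_grad : IntegrableOn (fun x => ‖gradient φ x‖ ^ (2 : ℝ)) (Metric.ball 0 1) :=
    h.integrable_norm_gradient_rpow _ two_pos
  have h_norm : IntegrableOn (fun x : E D => ‖x‖ ^ (2 : ℝ)) (Metric.ball 0 1) :=
    integrableOn_of_isBounded (continuous_norm_rpow continuous_id zero_le_two) Metric.isBounded_ball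
  have h_le : ∫ x, φ x ≤ ∫ x in Metric.ball (0 : E D) 1,
      (1 / 2 * ‖gradient φ x‖ ^ (2 : ℝ) + (1 / (D : ℝ)) ^ 2 / 2 * ‖x‖ ^ (2 : ℝ)) := by
    calc ∫ x, φ x = ∫ x in Metric.ball (0 : E D) 1, -(1 / D * inner ℝ (gradient φ x) x) := by
          rw [setIntegral_eq_integral_of_forall_compl_eq_zero fun x hx => by
              rw [h.gradient_eq_zero hx, inner_zero_left, mul_zero, neg_zero],
            integral_neg, integral_const_mul, h.integral_inner_gradient_self]
          field_simp
      _ ≤ _ := integral_mono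
          (integrableOn_of_isBounded (continuous_const.mul
            (h.continuous_gradient.inner continuous_id)).neg Metric.isBounded_ball)
          ((h_grad.const_mul _).add (h_norm.const_mul _))
          fun x => by
            simpa only [Pi.add_apply, Real.rpow_two] using neg_mul_inner_le (1 / D) (gradient φ x) x
  rw [integral_add (h_grad.const_mul _) (h_norm.const_mul _), integral_const_mul,
    integral_const_mul, setIntegral_norm_rpow_ball D two_pos,
    h.setIntegral_norm_gradient_rpow_eq two_ne_zero] at h_le
  calc energy 2 φ
      ≤ (1 / (D : ℝ)) ^ 2 / 2 * (D / (D + 2) * volume.real (Metric.ball (0 : E D) 1)) := by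
        rw [energy]
        linarith
    _ = volume.real (Metric.ball (0 : E D) 1) / (D * (D + 2)) / 2 := by field_simp

lemma torsionalRigidity_two_ball_le (D : ℕ) [NeZero D] :
    torsionalRigidity 2 (Metric.ball (0 : E D) 1) ≤
      volume.real (Metric.ball (0 : E D) 1) / (D * (D + 2)) := by
  have h_half := (isLUB_energies Real.HolderConjugate.two_two (ball_mem_convexDomains D)).2
    (Set.forall_mem_image.2 fun φ hφ => energy_two_le_of_ball hφ)
  exact (div_le_div_iff_of_pos_right two_pos).1 h_half

end Ball

section Ellipsoid

section InnerProductSpace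

variable {V : Type*} [NormedAddCommGroup V] [InnerProductSpace ℝ V] {e : V}

/-- The quadratic form `‖x‖² / 4 + 3 ⟪e, x⟫² / 4`; its open unit sublevel set, for a unit vector
`e`, is the ellipsoid with semiaxis `1` along `e` and semiaxes `2` orthogonally to `e`. -/
noncomputable def ellipsoidForm (e x : V) : ℝ := 1 / 4 * ‖x‖ ^ 2 + 3 / 4 * (inner ℝ e x) ^ 2

/-- Half the gradient of `ellipsoidForm`. -/
noncomputable def ellipsoidGrad (e x : V) : V :=
  (1 / 4 : ℝ) • x + (3 / 4 * inner ℝ e x : ℝ) • e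

lemma continuous_ellipsoidForm (e : V) : Continuous (ellipsoidForm e) := by
  unfold ellipsoidForm; fun_prop

lemma continuous_ellipsoidGrad (e : V) : Continuous (ellipsoidGrad e) := by
  unfold ellipsoidGrad; fun_prop

lemma ellipsoidForm_nonneg (e x : V) : 0 ≤ ellipsoidForm e x := by
  unfold ellipsoidForm; positivity

lemma ellipsoidForm_smul (e x : V) (s : ℝ) :
    ellipsoidForm e (s • x) = s ^ 2 * ellipsoidForm e x := by
  simp only [ellipsoidForm, norm_smul, real_inner_smul_right, mul_pow, Real.norm_eq_abs, sq_abs]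
  ring

lemma convexOn_ellipsoidForm (e : V) : ConvexOn ℝ Set.univ (ellipsoidForm e) :=
  ((convexOn_univ_norm.pow (fun x _ => norm_nonneg x) 2).smul (by norm_num)).add
    (((even_two.convexOn_pow (𝕜 := ℝ)).comp_linearMap (innerSL ℝ e).toLinearMap).smul
      (by norm_num))

lemma ellipsoidForm_sub (e y z : V) :
    ellipsoidForm e y - ellipsoidForm e z = inner ℝ (ellipsoidGrad e (y + z)) (y - z) := by
  simp only [ellipsoidForm, ellipsoidGrad, ← real_inner_self_eq_norm_sq, inner_add_left,
    inner_sub_right, inner_add_right, real_inner_smul_left]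
  rw [real_inner_comm z y]
  ring

lemma inner_sq_le_norm_sq (he : ‖e‖ = 1) (x : V) : inner ℝ e x ^ 2 ≤ ‖x‖ ^ 2 := by
  have h_abs := abs_real_inner_le_norm e x
  rw [he, one_mul] at h_abs
  exact sq_le_sq' (neg_le_of_abs_le h_abs) (le_of_abs_le h_abs)

lemma norm_ellipsoidGrad_sq (he : ‖e‖ = 1) (x : V) :
    ‖ellipsoidGrad e x‖ ^ 2 = ellipsoidForm e x - 3 / 16 * (‖x‖ ^ 2 - inner ℝ e x ^ 2) := by
  rw [ellipsoidForm, ellipsoidGrad, norm_add_sq_real, norm_smul, norm_smul, real_inner_smul_left,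
    real_inner_smul_right, real_inner_comm, he, mul_pow, mul_one, Real.norm_eq_abs, sq_abs,
    Real.norm_eq_abs, sq_abs]
  ring

lemma norm_ellipsoidGrad_le (he : ‖e‖ = 1) (x : V) : ‖ellipsoidGrad e x‖ ≤ ‖x‖ := by
  refine abs_le_of_sq_le_sq' ?_ (norm_nonneg x) |>.2
  rw [norm_ellipsoidGrad_sq he, ellipsoidForm]
  linarith [inner_sq_le_norm_sq he x]

lemma isSlopeBound_ellipsoidForm (he : ‖e‖ = 1) :
    IsSlopeBound (ellipsoidForm e) fun x => 2 * ‖ellipsoidGrad e x‖ := by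
  refine fun ε hε => ⟨ε / 2, half_pos hε, fun x y hy z hz => ?_⟩
  rw [mem_ball_iff_norm] at hy hz
  have h_split : ellipsoidGrad e (y + z) =
      (2 : ℝ) • ellipsoidGrad e x + ellipsoidGrad e ((y - x) + (z - x)) := by
    simp only [ellipsoidGrad, inner_add_right, inner_sub_right]
    module
  calc |ellipsoidForm e y - ellipsoidForm e z|
      ≤ ‖ellipsoidGrad e (y + z)‖ * ‖y - z‖ := by
        rw [ellipsoidForm_sub]
        exact abs_real_inner_le_norm _ _
    _ ≤ (2 * ‖ellipsoidGrad e x‖ + ε) * ‖y - z‖ := by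
        gcongr
        calc ‖ellipsoidGrad e (y + z)‖
            ≤ 2 * ‖ellipsoidGrad e x‖ + ‖(y - x) + (z - x)‖ := by
              rw [h_split]
              refine (norm_add_le _ _).trans (add_le_add ?_ (norm_ellipsoidGrad_le he _))
              rw [norm_smul, Real.norm_of_nonneg zero_le_two]
          _ ≤ 2 * ‖ellipsoidGrad e x‖ + ε := by linarith [norm_add_le (y - x) (z - x)]

lemma exists_norm_eq_one_inner_eq_zero (h : 1 < Module.finrank ℝ V) (e : V) :
    ∃ f : V, ‖f‖ = 1 ∧ inner ℝ e f = 0 := by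
  have := Module.finite_of_finrank_pos (zero_lt_one.trans h)
  have h_ker : (innerSL ℝ e).toLinearMap.ker ≠ ⊥ :=
    LinearMap.ker_ne_bot_of_finrank_lt (by rwa [Module.finrank_self])
  obtain ⟨v, hv, hv_ne⟩ := Submodule.exists_mem_ne_zero_of_ne_bot h_ker
  refine ⟨‖v‖⁻¹ • v, norm_smul_inv_norm (𝕜 := ℝ) hv_ne, ?_⟩
  rw [real_inner_smul_right, show inner ℝ e v = 0 from hv, mul_zero]

end InnerProductSpace

variable {D : ℕ} {e : E D}

/-- The ellipsoid with semiaxis `1` in the direction of the unit vector `e` and semiaxes `2`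
orthogonally to it: a convex domain of inradius at most that of the unit ball, at which `Q_2` is
smaller. -/
def ellipsoid (e : E D) : Set (E D) := {x | ellipsoidForm e x < 1}

lemma ellipsoid_mem_convexDomains (e : E D) : ellipsoid e ∈ convexDomains D := by
  refine ⟨isOpen_lt (continuous_ellipsoidForm e) continuous_const,
    (Metric.isBounded_ball (x := 0) (r := 2)).subset fun x hx => ?_, ?_, 0, ?_⟩
  · have h_form : ellipsoidForm e x < 1 := hx
    rw [ellipsoidForm] at h_form
    rw [mem_ball_zero_iff]
    nlinarith [sq_nonneg (inner ℝ e x), norm_nonneg x]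
  · simpa [ellipsoid] using (convexOn_ellipsoidForm e).convex_lt 1
  · simp [ellipsoid, ellipsoidForm]

lemma abs_inner_lt_one_of_mem_ellipsoid (he : ‖e‖ = 1) {x : E D} (hx : x ∈ ellipsoid e) :
    |inner ℝ e x| < 1 := by
  have h_form : ellipsoidForm e x < 1 := hx
  rw [ellipsoidForm] at h_form
  exact (sq_lt_one_iff_abs_lt_one _).1 (by linarith [inner_sq_le_norm_sq he x])

lemma inradius_ellipsoid_le (he : ‖e‖ = 1) : inradius (ellipsoid e) ≤ 1 := by
  refine Real.sSup_le ?_ zero_le_one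
  rintro r ⟨-, x, h_ball⟩
  by_contra! hr
  have h_slab (s : ℝ) (hs : |s| = 1) : |inner ℝ e x + s| < 1 := by
    have h_mem : x + s • e ∈ ellipsoid e := h_ball (by
      rwa [mem_ball_iff_norm, add_sub_cancel_left, norm_smul, he, Real.norm_eq_abs, hs, mul_one])
    simpa only [inner_add_right, real_inner_smul_right, real_inner_self_eq_norm_sq, he, one_pow,
      mul_one] using abs_inner_lt_one_of_mem_ellipsoid he h_mem
  linarith [(abs_lt.1 (h_slab 1 (by simp))).2, (abs_lt.1 (h_slab (-1) (by simp))).1]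

lemma setIntegral_ellipsoidForm (e : E D) :
    ∫ x in ellipsoid e, ellipsoidForm e x = D / (D + 2) * volume.real (ellipsoid e) := by
  have h_unit : {x | √(ellipsoidForm e x) < 1} = ellipsoid e := by
    ext x
    rw [Set.mem_ofPred_eq, Real.sqrt_lt' one_pos, one_pow, ellipsoid, Set.mem_ofPred_eq]
  have h_sqrt := setIntegral_rpow_of_homogeneous (μ := volume)
    (continuous_ellipsoidForm e).sqrt.measurable (fun x => Real.sqrt_nonneg _)
    (fun s hs x => by
      rw [ellipsoidForm_smul, Real.sqrt_mul (sq_nonneg s), Real.sqrt_sq (le_of_lt hs)])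
    (by rw [h_unit]; exact (ellipsoid_mem_convexDomains e).2.1.measure_lt_top.ne) two_pos
  simpa only [h_unit, Real.rpow_two, Real.sq_sqrt (ellipsoidForm_nonneg e _),
    finrank_euclideanSpace_fin] using h_sqrt

lemma setIntegral_norm_sq_sub_inner_sq_pos (hD : 2 ≤ D) (he : ‖e‖ = 1) :
    0 < ∫ x in ellipsoid e, (‖x‖ ^ 2 - inner ℝ e x ^ 2) := by
  have hΩ := ellipsoid_mem_convexDomains e
  have h_cont : Continuous fun x : E D => ‖x‖ ^ 2 - inner ℝ e x ^ 2 := by fun_prop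
  obtain ⟨f, hf, hef⟩ := exists_norm_eq_one_inner_eq_zero (V := E D)
    (by rw [finrank_euclideanSpace_fin]; exact hD) e
  rw [setIntegral_pos_iff_support_of_nonneg_ae
    (ae_of_all _ fun x => sub_nonneg.2 (inner_sq_le_norm_sq he x))
    (integrableOn_of_isBounded h_cont hΩ.2.1)]
  refine (h_cont.isOpen_support.inter hΩ.1).measure_pos volume ⟨f, ?_, ?_⟩
  · simp [hf, hef]
  · rw [ellipsoid, Set.mem_ofPred_eq, ellipsoidForm, hf, hef]
    norm_num

lemma setIntegral_max_one_sub_ellipsoidForm (e : E D) :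
    ∫ x in ellipsoid e, max (1 - ellipsoidForm e x) 0 =
      volume.real (ellipsoid e) - D / (D + 2) * volume.real (ellipsoid e) := by
  have hΩ := ellipsoid_mem_convexDomains e
  rw [setIntegral_congr_fun (g := fun x => 1 - ellipsoidForm e x) hΩ.1.measurableSet
      fun x hx => max_eq_left (sub_nonneg.2 (le_of_lt hx)),
    integral_sub (integrableOn_const (C := (1 : ℝ)) hΩ.2.1.measure_lt_top.ne)
      (integrableOn_of_isBounded (continuous_ellipsoidForm e) hΩ.2.1),
    setIntegral_const, smul_eq_mul, mul_one, setIntegral_ellipsoidForm]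

lemma setIntegral_norm_ellipsoidGrad_sq (he : ‖e‖ = 1) :
    ∫ x in ellipsoid e, ‖ellipsoidGrad e x‖ ^ 2 = D / (D + 2) * volume.real (ellipsoid e) -
      3 / 16 * ∫ x in ellipsoid e, (‖x‖ ^ 2 - inner ℝ e x ^ 2) := by
  have hb := (ellipsoid_mem_convexDomains e).2.1
  simp only [norm_ellipsoidGrad_sq he]
  rw [integral_sub (integrableOn_of_isBounded (continuous_ellipsoidForm e) hb)
    (integrableOn_of_isBounded (by fun_prop) hb), integral_const_mul, setIntegral_ellipsoidForm]

-- The competitor `(1 - ellipsoidForm e) / (2 D)` imitates the torsion function `(1 - ‖x‖²) / (2 D)`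
-- of the unit ball; the doubled semiaxes make its gradient strictly shorter.
lemma lt_torsionalRigidity_two_ellipsoid (hD : 2 ≤ D) (he : ‖e‖ = 1) :
    volume.real (ellipsoid e) / (D * (D + 2)) < torsionalRigidity 2 (ellipsoid e) := by
  have : NeZero D := ⟨by lia⟩
  have hΩ := ellipsoid_mem_convexDomains e
  have h_slope := (((isSlopeBound_ellipsoidForm he).const_sub 1).max_zero).const_mul
    (show (0 : ℝ) < 1 / (2 * D) by positivity)
  have h_energy := h_slope.energy_le two_pos hΩ.1 hΩ.2.1
    (fun x hx => by rw [max_eq_right (sub_nonpos.2 (not_lt.1 hx)), mul_zero])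
    (continuous_const.mul (continuous_const.mul (continuous_ellipsoidGrad e).norm))
    (fun x => by positivity) (isLUB_energies Real.HolderConjugate.two_two hΩ).1
  simp only [Real.rpow_two, mul_pow, integral_const_mul] at h_energy
  rw [setIntegral_max_one_sub_ellipsoidForm, setIntegral_norm_ellipsoidGrad_sq he] at h_energy
  set κ := ∫ x in ellipsoid e, (‖x‖ ^ 2 - inner ℝ e x ^ 2)
  have hκ : 0 < κ := setIntegral_norm_sq_sub_inner_sq_pos hD he
  calc volume.real (ellipsoid e) / (D * (D + 2))
      < volume.real (ellipsoid e) / (D * (D + 2)) + 3 / 16 * κ / D ^ 2 :=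
        lt_add_of_pos_right _ (by positivity)
    _ = 2 * (1 / (2 * D) * (volume.real (ellipsoid e) -
          D / (D + 2) * volume.real (ellipsoid e)) - 1 / 2 * ((1 / (2 * D)) ^ 2 * (2 ^ 2 *
          (D / (D + 2) * volume.real (ellipsoid e) - 3 / 16 * κ)))) := by
        field_simp
        ring
    _ ≤ torsionalRigidity 2 (ellipsoid e) := by linarith

end Ellipsoid

section MeanTorsion

variable {D : ℕ} {p q : ℝ} {Ω : Set (E D)}

lemma volume_real_pos (hΩ : Ω ∈ convexDomains D) : 0 < volume.real Ω :=
  ENNReal.toReal_pos (hΩ.1.measure_pos volume hΩ.2.2.2).ne' hΩ.2.1.measure_lt_top.ne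

/-- The mean of the `p`-torsion function over `Ω`; together with the inradius it determines
`Q p Ω`. -/
noncomputable def meanTorsion (p : ℝ) (Ω : Set (E D)) : ℝ :=
  torsionalRigidity p Ω / volume.real Ω

lemma exists_ball_subset_of_lt_inradius {r : ℝ} (hr : 0 ≤ r) (h : r < inradius Ω) :
    ∃ x, Metric.ball x r ⊆ Ω := by
  have h_nonempty : {r : ℝ | 0 < r ∧ ∃ x, Metric.ball x r ⊆ Ω}.Nonempty := by
    by_contra h_empty
    rw [inradius, Set.not_nonempty_iff_eq_empty.1 h_empty, Real.sSup_empty] at h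
    exact h.not_ge hr
  obtain ⟨s, ⟨-, x, hx⟩, hrs⟩ := exists_lt_of_lt_csSup h_nonempty h
  exact ⟨x, (Metric.ball_subset_ball hrs.le).trans hx⟩

variable [NeZero D]

lemma meanTorsion_le (hpq : p.HolderConjugate q) (hΩ : Ω ∈ convexDomains D) :
    meanTorsion p Ω ≤ inradius Ω ^ q / (q + 1) := by
  have hq := hpq.symm.pos
  have h_lub := (isLUB_energies hpq hΩ).2
    (Set.forall_mem_image.2 fun φ hφ => energy_le_makai hpq hΩ hφ)
  rw [div_le_iff₀ hq] at h_lub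
  rw [meanTorsion, div_le_iff₀ (volume_real_pos hΩ)]
  calc torsionalRigidity p Ω ≤ inradius Ω ^ q / (q * (q + 1)) * volume.real Ω * q := h_lub
    _ = inradius Ω ^ q / (q + 1) * volume.real Ω := by field_simp

lemma le_meanTorsion (hpq : p.HolderConjugate q) (hΩ : Ω ∈ convexDomains D) :
    D * (inradius Ω / D) ^ q / (D + q) ≤ meanTorsion p Ω := by
  have hq := hpq.symm.pos
  have h_cont : Continuous fun r : ℝ => D * (r / D) ^ q / (D + q) :=
    (continuous_const.mul
      ((continuous_id.div_const _).rpow_const fun _ => Or.inr hq.le)).div_const _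
  refine le_of_tendsto (h_cont.continuousWithinAt (s := Set.Iio (inradius Ω))) ?_
  filter_upwards [Ioo_mem_nhdsLT (inradius_pos hΩ)] with r hr
  obtain ⟨x, hx⟩ := exists_ball_subset_of_lt_inradius hr.1.le hr.2
  have h_ball := le_of_ball_subset hpq hΩ hr.1 hx (isLUB_energies hpq hΩ).1
  rwa [div_le_div_iff_of_pos_right hq, mul_comm, ← le_div_iff₀ (volume_real_pos hΩ)] at h_ball

lemma meanTorsion_pos (hp : 1 < p) (hΩ : Ω ∈ convexDomains D) : 0 < meanTorsion p Ω := by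
  have hpq := Real.HolderConjugate.conjExponent hp
  have hq := hpq.symm.pos
  have hD : (0 : ℝ) < D := Nat.cast_pos.2 (NeZero.pos D)
  have h_inradius := inradius_pos hΩ
  exact lt_of_lt_of_le (by positivity) (le_meanTorsion hpq hΩ)

lemma normRigidity_eq (hp : 1 < p) (hΩ : Ω ∈ convexDomains D) :
    normRigidity p Ω = meanTorsion p Ω ^ (1 - p) := by
  have hV := volume_real_pos hΩ
  have hT : 0 < torsionalRigidity p Ω :=
    (div_pos_iff_of_pos_right hV).1 (meanTorsion_pos hp hΩ)
  rw [normRigidity, meanTorsion, Real.div_rpow hT.le hV.le, ← neg_sub 1 p, Real.rpow_neg hV.le,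
    div_eq_inv_mul]

open scoped Pointwise in
lemma meanTorsion_smul (hpq : p.HolderConjugate q) (hΩ : Ω ∈ convexDomains D) {t : ℝ}
    (ht : 0 < t) : meanTorsion p (t • Ω) = t ^ q * meanTorsion p Ω := by
  have hV := volume_real_pos hΩ
  rw [meanTorsion, meanTorsion, torsionalRigidity_smul hpq hΩ ht, volume_real_smul Ω ht.le]
  field_simp

end MeanTorsion

section Q

variable {D : ℕ} [NeZero D] {p q : ℝ} {Ω A B : Set (E D)}

lemma two_mul_sub_one_div (hpq : p.HolderConjugate q) : (2 * p - 1) / (p - 1) = q + 1 := by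
  have hp := hpq.sub_one_ne_zero
  rw [hpq.conjugate_eq]
  field_simp
  ring

lemma Q_nonneg (hp : 1 < p) (hΩ : Ω ∈ convexDomains D) : 0 ≤ Q p Ω := by
  have hpq := Real.HolderConjugate.conjExponent hp
  have hq := hpq.symm.pos
  have h_mean := meanTorsion_pos hp hΩ
  have h_inradius := inradius_pos hΩ
  rw [Q, normRigidity_eq hp hΩ, two_mul_sub_one_div hpq]
  positivity

lemma Q_rpow (hpq : p.HolderConjugate q) (hΩ : Ω ∈ convexDomains D) :
    Q p Ω ^ p = normRigidity p Ω * inradius Ω ^ p / (q + 1) ^ (p - 1) := by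
  have h_mean := meanTorsion_pos hpq.lt hΩ
  have h_inradius := inradius_pos hΩ
  have hq := hpq.symm.pos
  rw [Q, two_mul_sub_one_div hpq, one_div, Real.rpow_inv_rpow ?_ hpq.ne_zero]
  rw [normRigidity_eq hpq.lt hΩ]
  positivity

-- Raising `Q` to the power `q` instead of `p` removes all other exponents.
lemma Q_rpow_conjExponent (hpq : p.HolderConjugate q) (hΩ : Ω ∈ convexDomains D) :
    Q p Ω ^ q = inradius Ω ^ q / ((q + 1) * meanTorsion p Ω) := by
  have h_mean := meanTorsion_pos hpq.lt hΩ
  have h_inradius := inradius_pos hΩ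
  have hq := hpq.symm.pos
  have h_prod : 0 < (q + 1) * meanTorsion p Ω := by positivity
  have h_exp : (1 - p) * (q - 1) = -1 := by linarith [hpq.mul_eq_add]
  have h_exp' : p * (q - 1) = q := by linarith [hpq.mul_eq_add]
  calc Q p Ω ^ q = (Q p Ω ^ p) ^ (q - 1) := by rw [← Real.rpow_mul (Q_nonneg hpq.lt hΩ), h_exp']
    _ = (((q + 1) * meanTorsion p Ω) ^ (1 - p) * inradius Ω ^ p) ^ (q - 1) := by
        rw [Q_rpow hpq hΩ, normRigidity_eq hpq.lt hΩ, Real.mul_rpow (by positivity) h_mean.le,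
          ← neg_sub 1 p, Real.rpow_neg (by positivity), div_inv_eq_mul]
        ring_nf
    _ = inradius Ω ^ q / ((q + 1) * meanTorsion p Ω) := by
        rw [Real.mul_rpow (by positivity) (by positivity), ← Real.rpow_mul h_prod.le,
          ← Real.rpow_mul h_inradius.le, h_exp, h_exp', Real.rpow_neg_one, ← div_eq_inv_mul]

lemma one_le_Q (hp : 1 < p) (hΩ : Ω ∈ convexDomains D) : 1 ≤ Q p Ω := by
  have hpq := Real.HolderConjugate.conjExponent hp
  have hq := hpq.symm.pos
  have h_mean := meanTorsion_pos hp hΩ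
  rw [← Real.rpow_le_rpow_iff zero_le_one (Q_nonneg hp hΩ) hq, Real.one_rpow,
    Q_rpow_conjExponent hpq hΩ, one_le_div (by positivity), mul_comm, ← le_div_iff₀ (by positivity)]
  exact meanTorsion_le hpq hΩ

lemma Q_le (hp : 1 < p) (hΩ : Ω ∈ convexDomains D) : Q p Ω ≤ D := by
  have hpq := Real.HolderConjugate.conjExponent hp
  set q := p.conjExponent
  have hq := hpq.symm.pos
  have h_mean := meanTorsion_pos hp hΩ
  have h_inradius := inradius_pos hΩ
  have hD : (1 : ℝ) ≤ D := Nat.one_le_cast.2 (NeZero.one_le)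
  have hD_pos : (0 : ℝ) < D := zero_lt_one.trans_le hD
  have h_coef : D + q ≤ (q + 1) * D := by nlinarith
  rw [← Real.rpow_le_rpow_iff (Q_nonneg hp hΩ) hD_pos.le hq, Q_rpow_conjExponent hpq hΩ,
    div_le_comm₀ (by positivity) (by positivity), ← Real.div_rpow h_inradius.le hD_pos.le]
  calc (inradius Ω / D) ^ q
      ≤ (q + 1) * D / (D + q) * (inradius Ω / D) ^ q :=
        le_mul_of_one_le_left (by positivity) ((one_le_div (by positivity)).2 h_coef)
    _ = (q + 1) * (D * (inradius Ω / D) ^ q / (D + q)) := by ring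
    _ ≤ (q + 1) * meanTorsion p Ω := by
        gcongr
        exact le_meanTorsion hpq hΩ

lemma Q_lt_Q_of_inradius_le (hp : 1 < p) (hA : A ∈ convexDomains D) (hB : B ∈ convexDomains D)
    (h_inradius : inradius A ≤ inradius B) (h_mean : meanTorsion p B < meanTorsion p A) :
    Q p A < Q p B := by
  have hpq := Real.HolderConjugate.conjExponent hp
  have hq := hpq.symm.pos
  have hA_inradius := inradius_pos hA
  have hB_mean := meanTorsion_pos hp hB
  rw [← Real.rpow_lt_rpow_iff (Q_nonneg hp hA) (Q_nonneg hp hB) hq, Q_rpow_conjExponent hpq hA,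
    Q_rpow_conjExponent hpq hB]
  have hB_inradius := hA_inradius.trans_le h_inradius
  exact div_lt_div₀' (by gcongr) (by gcongr) (by positivity) (by positivity)

lemma normRigidity_lt_iff {a b : ℝ} (hp : 1 < p) (hA : A ∈ convexDomainsOfInradius D a)
    (hB : B ∈ convexDomainsOfInradius D b) :
    normRigidity p A < normRigidity p B ↔ Q p A * b < Q p B * a := by
  obtain ⟨hA, rfl⟩ := hA
  obtain ⟨hB, rfl⟩ := hB
  have hpq := Real.HolderConjugate.conjExponent hp
  have hq := hpq.symm.pos
  have h_eq {Ω : Set (E D)} (hΩ : Ω ∈ convexDomains D) :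
      normRigidity p Ω = (Q p Ω / inradius Ω) ^ p * (p.conjExponent + 1) ^ (p - 1) := by
    have h_inradius := inradius_pos hΩ
    rw [Real.div_rpow (Q_nonneg hp hΩ) h_inradius.le, Q_rpow hpq hΩ]
    field_simp
  rw [h_eq hA, h_eq hB, mul_lt_mul_iff_left₀ (by positivity),
    Real.rpow_lt_rpow_iff (div_nonneg (Q_nonneg hp hA) (inradius_pos hA).le)
      (div_nonneg (Q_nonneg hp hB) (inradius_pos hB).le) hpq.pos,
    div_lt_div_iff₀ (inradius_pos hA) (inradius_pos hB)]

open scoped Pointwise in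
lemma Q_smul (hp : 1 < p) (hΩ : Ω ∈ convexDomains D) {t : ℝ} (ht : 0 < t) :
    Q p (t • Ω) = Q p Ω := by
  have hpq := Real.HolderConjugate.conjExponent hp
  have htΩ := smul_mem_convexDomains hΩ ht.ne'
  rw [← Real.rpow_left_inj (Q_nonneg hp htΩ) (Q_nonneg hp hΩ) hpq.symm.ne_zero,
    Q_rpow_conjExponent hpq htΩ, Q_rpow_conjExponent hpq hΩ, inradius_smul Ω ht,
    meanTorsion_smul hpq hΩ ht, Real.mul_rpow ht.le (inradius_pos hΩ).le, mul_left_comm,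
    mul_div_mul_left _ _ (by positivity)]

lemma exists_mem_convexDomainsOfInradius_Q_eq (hp : 1 < p) (hΩ : Ω ∈ convexDomains D) {r : ℝ}
    (hr : 0 < r) : ∃ Ω' ∈ convexDomainsOfInradius D r, Q p Ω' = Q p Ω := by
  have h_inradius := inradius_pos hΩ
  have ht : 0 < r / inradius Ω := by positivity
  exact ⟨_, ⟨smul_mem_convexDomains hΩ ht.ne',
    by rw [inradius_smul Ω ht, div_mul_cancel₀ _ h_inradius.ne']⟩, Q_smul hp hΩ ht⟩

lemma exists_Q_two_lt_Q_two (hD : 2 ≤ D) :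
    ∃ A ∈ convexDomains D, ∃ B ∈ convexDomains D, Q 2 A < Q 2 B := by
  obtain ⟨e, he⟩ : ∃ e : E D, ‖e‖ = 1 := ⟨EuclideanSpace.single 0 1, by simp⟩
  have hA := ellipsoid_mem_convexDomains e
  have hB := ball_mem_convexDomains D
  refine ⟨_, hA, _, hB, Q_lt_Q_of_inradius_le one_lt_two hA hB
    ((inradius_ellipsoid_le he).trans (le_inradius hB.2.1 one_pos subset_rfl)) ?_⟩
  calc meanTorsion 2 (Metric.ball (0 : E D) 1) ≤ 1 / (D * (D + 2)) := by
        rw [meanTorsion, div_le_iff₀ (volume_real_pos hB), one_div_mul_eq_div]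
        exact torsionalRigidity_two_ball_le D
    _ < meanTorsion 2 (ellipsoid e) := by
        rw [meanTorsion, lt_div_iff₀ (volume_real_pos hA), one_div_mul_eq_div]
        exact lt_torsionalRigidity_two_ellipsoid hD he

end Q

section Gamma

variable {D : ℕ} [NeZero D] {p : ℝ} {Ω A B : Set (E D)}

instance nonempty_convexDomains (D : ℕ) : Nonempty (convexDomains D) :=
  ⟨⟨_, ball_mem_convexDomains D⟩⟩

lemma alpha_le_Q (hp : 1 < p) (hΩ : Ω ∈ convexDomains D) : alpha D p ≤ Q p Ω :=
  ciInf_le (f := fun Ω : convexDomains D => Q p (Ω : Set (E D)))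
    ⟨1, Set.forall_mem_range.2 fun Ω => one_le_Q hp Ω.2⟩ ⟨Ω, hΩ⟩

lemma Q_le_beta (hp : 1 < p) (hΩ : Ω ∈ convexDomains D) : Q p Ω ≤ beta D p :=
  le_ciSup (f := fun Ω : convexDomains D => Q p (Ω : Set (E D)))
    ⟨D, Set.forall_mem_range.2 fun Ω => Q_le hp Ω.2⟩ ⟨Ω, hΩ⟩

lemma one_le_alpha (hp : 1 < p) : 1 ≤ alpha D p :=
  le_ciInf fun Ω => one_le_Q hp Ω.2

lemma beta_le (hp : 1 < p) : beta D p ≤ D :=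
  ciSup_le fun Ω => Q_le hp Ω.2

lemma beta_pos (hp : 1 < p) : 0 < beta D p :=
  (zero_lt_one.trans_le (one_le_Q hp (ball_mem_convexDomains D))).trans_le
    (Q_le_beta hp (ball_mem_convexDomains D))

lemma one_div_le_gammaDp (hp : 1 < p) : 1 / (D : ℝ) ≤ gammaDp D p :=
  div_le_div₀ (zero_le_one.trans (one_le_alpha hp)) (one_le_alpha hp) (beta_pos hp) (beta_le hp)

lemma gammaD_le_gammaDp (hp : 1 < p) : gammaD D ≤ gammaDp D p :=
  ciInf_le (f := fun p : Set.Ioi (1 : ℝ) => gammaDp D (p : ℝ))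
    ⟨1 / (D : ℝ), Set.forall_mem_range.2 fun p => one_div_le_gammaDp p.2⟩ ⟨p, hp⟩

lemma one_div_le_gammaD : 1 / (D : ℝ) ≤ gammaD D :=
  le_ciInf fun p => one_div_le_gammaDp p.2

lemma gammaD_pos : 0 < gammaD D :=
  (one_div_pos.2 (Nat.cast_pos.2 (NeZero.pos D))).trans_le one_div_le_gammaD

lemma gammaD_lt_one (hD : 2 ≤ D) : gammaD D < 1 := by
  refine (gammaD_le_gammaDp one_lt_two).trans_lt ?_
  obtain ⟨A, hA, B, hB, h_lt⟩ := exists_Q_two_lt_Q_two hD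
  rw [gammaDp, div_lt_one (beta_pos one_lt_two)]
  exact ((alpha_le_Q one_lt_two hA).trans_lt h_lt).trans_le (Q_le_beta one_lt_two hB)

lemma exists_Q_lt_mul_Q {c : ℝ} (h : gammaD D < c) :
    ∃ p : ℝ, 1 < p ∧ ∃ A ∈ convexDomains D, ∃ B ∈ convexDomains D, Q p A < c * Q p B := by
  have hc : 0 < c := gammaD_pos.trans h
  obtain ⟨⟨p, hp : 1 < p⟩, h_gamma⟩ := exists_lt_of_ciInf_lt h
  have h_alpha : alpha D p < c * beta D p := (div_lt_iff₀ (beta_pos hp)).1 h_gamma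
  obtain ⟨⟨A, hA⟩, h_beta⟩ := exists_lt_of_ciInf_lt h_alpha
  obtain ⟨⟨B, hB⟩, h_lt⟩ := exists_lt_of_lt_ciSup ((div_lt_iff₀' hc).2 h_beta)
  exact ⟨p, hp, A, hA, B, hB, (div_lt_iff₀' hc).1 h_lt⟩

lemma gammaD_mul_Q_le (hp : 1 < p) (hA : A ∈ convexDomains D) (hB : B ∈ convexDomains D) :
    gammaD D * Q p B ≤ Q p A :=
  calc gammaD D * Q p B ≤ gammaDp D p * beta D p :=
        mul_le_mul (gammaD_le_gammaDp hp) (Q_le_beta hp hB) (Q_nonneg hp hB)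
          (gammaD_pos.le.trans (gammaD_le_gammaDp hp))
    _ = alpha D p := div_mul_cancel₀ _ (beta_pos hp).ne'
    _ ≤ Q p A := alpha_le_Q hp hA

lemma exists_normRigidity_lt {a b : ℝ} (ha : 0 < a) (hb : 0 < b) (h : gammaD D * b < a) :
    ∃ p : ℝ, 1 < p ∧ ∃ Ωa ∈ convexDomainsOfInradius D a, ∃ Ωb ∈ convexDomainsOfInradius D b,
      normRigidity p Ωa < normRigidity p Ωb := by
  obtain ⟨p, hp, A, hA, B, hB, h_lt⟩ := exists_Q_lt_mul_Q ((lt_div_iff₀ hb).2 h)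
  obtain ⟨A', hA', hQA⟩ := exists_mem_convexDomainsOfInradius_Q_eq hp hA ha
  obtain ⟨B', hB', hQB⟩ := exists_mem_convexDomainsOfInradius_Q_eq hp hB hb
  refine ⟨p, hp, A', hA', B', hB', (normRigidity_lt_iff hp hA' hB').2 ?_⟩
  rwa [hQA, hQB, ← lt_div_iff₀ hb, mul_comm, mul_div_right_comm]

lemma normRigidity_le {a b : ℝ} (hp : 1 < p) (h : a ≤ gammaD D * b)
    (hA : A ∈ convexDomainsOfInradius D a) (hB : B ∈ convexDomainsOfInradius D b) :
    normRigidity p B ≤ normRigidity p A := by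
  have hb : 0 ≤ b := hB.2 ▸ (inradius_pos hB.1).le
  rw [← not_lt, normRigidity_lt_iff hp hA hB, not_lt]
  calc Q p B * a ≤ Q p B * (gammaD D * b) := mul_le_mul_of_nonneg_left h (Q_nonneg hp hB.1)
    _ = gammaD D * Q p B * b := by ring
    _ ≤ Q p A * b := mul_le_mul_of_nonneg_right (gammaD_mul_Q_le hp hA.1 hB.1) hb

lemma normRigidity_lt {a b : ℝ} (hp : 1 < p) (h : a < gammaD D * b)
    (hA : A ∈ convexDomainsOfInradius D a) (hB : B ∈ convexDomainsOfInradius D b) :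
    normRigidity p B < normRigidity p A := by
  have hb : 0 ≤ b := hB.2 ▸ (inradius_pos hB.1).le
  rw [normRigidity_lt_iff hp hB hA]
  calc Q p B * a < Q p B * (gammaD D * b) :=
        mul_lt_mul_of_pos_left h (zero_lt_one.trans_le (one_le_Q hp hB.1))
    _ = gammaD D * Q p B * b := by ring
    _ ≤ Q p A * b := mul_le_mul_of_nonneg_right (gammaD_mul_Q_le hp hA.1 hB.1) hb

end Gamma

end PTorsion

theorem mainTheorem2 (D : ℕ) (hD : 2 ≤ D) :
    PTorsion.gammaD D ∈ Set.Ico (1 / (D : ℝ)) 1 ∧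
    ∀ a b : ℝ, 0 < a → a < b →
      (PTorsion.gammaD D * b < a →
        ∃ p : ℝ, 1 < p ∧
          ∃ Ωa ∈ PTorsion.convexDomainsOfInradius D a,
          ∃ Ωb ∈ PTorsion.convexDomainsOfInradius D b,
            PTorsion.normRigidity p Ωa < PTorsion.normRigidity p Ωb) ∧
      (a ≤ PTorsion.gammaD D * b →
        ∀ Ωa ∈ PTorsion.convexDomainsOfInradius D a,
        ∀ Ωb ∈ PTorsion.convexDomainsOfInradius D b,
        ∀ p : ℝ, 1 < p → PTorsion.normRigidity p Ωb ≤ PTorsion.normRigidity p Ωa) ∧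
      (a < PTorsion.gammaD D * b →
        ∀ Ωa ∈ PTorsion.convexDomainsOfInradius D a,
        ∀ Ωb ∈ PTorsion.convexDomainsOfInradius D b,
        ∀ p : ℝ, 1 < p → PTorsion.normRigidity p Ωb < PTorsion.normRigidity p Ωa) := by
  have : NeZero D := ⟨by lia⟩
  refine ⟨⟨PTorsion.one_div_le_gammaD, PTorsion.gammaD_lt_one hD⟩, fun a b ha hab => ?_⟩
  exact ⟨PTorsion.exists_normRigidity_lt ha (ha.trans hab),
    fun h Ωa hΩa Ωb hΩb p hp => PTorsion.normRigidity_le hp h hΩa hΩb,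
    fun h Ωa hΩa Ωb hΩb p hp => PTorsion.normRigidity_lt hp h hΩa hΩb⟩
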